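/- Let $p$ be a prime ($p=2$ is allowed), let $\mathbb F_p$ be the field with $p$ elements, and let $m_1>m_2>m_3\ge 1$ be integers. For odd $p$ fix a square non-residue $\eta\in\mathbb F_p$. Consider the finite $p$-groups $G$ with $d(G)=3$, $\Phi(G)\le Z(G)$ and $G'\cong C_p^3$ such that $G/G'$ has type $(p^{m_1},p^{m_2},p^{m_3})$, i.e. $G/G'\cong C_{p^{m_1}}\times C_{p^{m_2}}\times C_{p^{m_3}}$. Here $d(G)$ is the minimal number of generators of $G$. A $3\times3$ matrix $w=(w_{ij})$ over $\mathbb F_p$ is called a characteristic matrix of such a group $G$ if there are $a_1,a_2,a_3\in G$ such that $G/G'=\langle a_1G'\rangle\times\langle a_2G'\rangle\times\langle a_3G'\rangle$, $a_iG'$ has order $p^{m_i}$, and $$a_i^{p^{m_i}}=x^{w_{i1}}y^{w_{i2}}z^{w_{i3}}\quad(i=1,2,3),\qquad x=[a_2,a_3],\ y=[a_3,a_1],\ z=[a_1,a_2].$$ Then every such group $G$ has a characteristic matrix in the list below. Different matrices of the list give non-isomorphic groups: if $w\ne w'$ are in the list and $G$, $H$ are such groups with characteristic matrices $w$ and $w'$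 respectively, then $G\not\cong H$. Moreover every matrix of the list is a characteristic matrix of some such group. In the list, $t$ runs over the non-zero elements of $\mathbb F_p$, and each of $\nu,\nu_1,\nu_2$ is, independently, $1$ or $\eta$ if $p$ is odd, and $1$ if $p=2$: (A1) $\begin{pmatrix}1&0&0\\0&\nu_1&0\\0&0&\nu_2\end{pmatrix}$, (A2) $\begin{pmatrix}1&0&0\\0&0&1\\0&t&0\end{pmatrix}$, (A3) $\begin{pmatrix}0&0&t\\0&1&0\\1&0&0\end{pmatrix}$, (A4) $\begin{pmatrix}0&0&1\\1&0&0\\0&1&0\end{pmatrix}$, (A5) $\begin{pmatrix}0&1&0\\0&0&1\\1&0&0\end{pmatrix}$, (A6) $\begin{pmatrix}0&t&0\\1&0&0\\0&0&1\end{pmatrix}$; (B1) $\begin{pmatrix}1&0&0\\0&\nu&0\\0&0&0\end{pmatrix}$, (B2) $\begin{pmatrix}1&0&0\\0&0&1\\0&0&0\end{pmatrix}$, (B3) $\begin{pmatrix}0&0&1\\0&1&0\\0&0&0\end{pmatrix}$, (B4) $\begin{pmatrix}0&1&0\\0&0&1\\0&0&0\end{pmatrix}$, (B5) $\begin{pmatrix}0&0&1\\0&0&0\\0&1&0\end{pmatrix}$,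 (B6) $\begin{pmatrix}1&0&0\\0&0&0\\0&0&\nu\end{pmatrix}$, (B7) $\begin{pmatrix}1&0&0\\0&0&0\\0&1&0\end{pmatrix}$, (B8) $\begin{pmatrix}0&1&0\\0&0&0\\0&0&1\end{pmatrix}$, (B9) $\begin{pmatrix}0&0&0\\0&1&0\\1&0&0\end{pmatrix}$, (B10) $\begin{pmatrix}0&0&0\\0&0&1\\1&0&0\end{pmatrix}$, (B11) $\begin{pmatrix}0&0&0\\1&0&0\\0&0&1\end{pmatrix}$, (B12) $\begin{pmatrix}0&0&0\\1&0&0\\0&1&0\end{pmatrix}$, (B13) $\begin{pmatrix}0&1&0\\0&0&0\\1&0&0\end{pmatrix}$, (B14) $\begin{pmatrix}0&0&t\\0&0&0\\1&0&0\end{pmatrix}$, (B15) $\begin{pmatrix}0&0&1\\1&0&0\\0&0&0\end{pmatrix}$, (B16) $\begin{pmatrix}0&t&0\\1&0&0\\0&0&0\end{pmatrix}$, (B17) $\begin{pmatrix}0&0&0\\0&1&0\\0&0&\nu\end{pmatrix}$, (B18) $\begin{pmatrix}0&0&0\\0&0&1\\0&t&0\end{pmatrix}$; (C1) $\begin{pmatrix}1&0&0\\0&0&0\\0&0&0\end{pmatrix}$,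 (C2) $\begin{pmatrix}0&1&0\\0&0&0\\0&0&0\end{pmatrix}$, (C3) $\begin{pmatrix}0&0&1\\0&0&0\\0&0&0\end{pmatrix}$, (C4) $\begin{pmatrix}0&0&0\\1&0&0\\0&0&0\end{pmatrix}$, (C5) $\begin{pmatrix}0&0&0\\0&1&0\\0&0&0\end{pmatrix}$, (C6) $\begin{pmatrix}0&0&0\\0&0&1\\0&0&0\end{pmatrix}$, (C7) $\begin{pmatrix}0&0&0\\0&0&0\\0&0&1\end{pmatrix}$, (C8) $\begin{pmatrix}0&0&0\\0&0&0\\0&1&0\end{pmatrix}$, (C9) $\begin{pmatrix}0&0&0\\0&0&0\\1&0&0\end{pmatrix}$, (C10) $\begin{pmatrix}0&0&0\\0&0&0\\0&0&0\end{pmatrix}$. -/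

import Mathlib

open scoped commutatorElement

/-- The finite `p`-groups `G` with `d(G) = 3`, `Φ(G) ≤ Z(G)`, `G' ≅ C_p³` and `G / G'` of type
`(p ^ m 0, p ^ m 1, p ^ m 2)`. -/
structure IsThreeGenGroup (p : ℕ) (m : Fin 3 → ℕ) (G : Type*) [Group G] [Finite G] : Prop where
  isPGroup : IsPGroup p G
  rank_eq : Group.rank G = 3
  frattini_le_center : frattini G ≤ Subgroup.center G
  derived : Nonempty (commutator G ≃* Multiplicative (Fin 3 → ZMod p))
  abelianization :
    Nonempty (Abelianization G ≃* ((i : Fin 3) → Multiplicative (ZMod (p ^ m i))))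

/-- `a 0, a 1, a 2` is a set of characteristic generators of `G` about the matrix `w`:
`G / G'` is the internal direct product of the cyclic groups `⟨a i G'⟩` of orders `p ^ m i`, and
`(a i) ^ (p ^ m i) = x ^ w i 0 * y ^ w i 1 * z ^ w i 2`, where
`x = [a 1, a 2]`, `y = [a 2, a 0]`, `z = [a 0, a 1]` (indices counted from `0`).
For the groups of `IsThreeGenGroup` the elements `x`, `y`, `z` are central of order `p`, so the
choice of representatives `ZMod.val` of the exponents and the convention for the commutator
(`a b a⁻¹ b⁻¹` or `a⁻¹ b⁻¹ a b`) do not matter. -/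
structure IsCharacteristicGenerators (p : ℕ) (m : Fin 3 → ℕ) {G : Type*} [Group G]
    (w : Matrix (Fin 3) (Fin 3) (ZMod p)) (a : Fin 3 → G) : Prop where
  orderOf_eq : ∀ i, orderOf (Abelianization.of (a i)) = p ^ m i
  directProduct : Function.Bijective
    (fun k : (i : Fin 3) → Subgroup.zpowers (Abelianization.of (a i)) =>
      ∏ i, (k i : Abelianization G))
  pow_eq : ∀ i, a i ^ p ^ m i =
    ⁅a 1, a 2⁆ ^ (w i 0).val * ⁅a 2, a 0⁆ ^ (w i 1).val * ⁅a 0, a 1⁆ ^ (w i 2).val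

/-- `w` is a characteristic matrix of `G` (for some choice of the generators). -/
def IsCharacteristicMatrix (p : ℕ) (m : Fin 3 → ℕ) (G : Type*) [Group G]
    (w : Matrix (Fin 3) (Fin 3) (ZMod p)) : Prop :=
  ∃ a : Fin 3 → G, IsCharacteristicGenerators p m w a

/-- The parameter `ν` is `1` or, for odd `p`, `η`. -/
def IsOneOrEta (p : ℕ) (η ν : ZMod p) : Prop :=
  ν = 1 ∨ (p ≠ 2 ∧ ν = η)

/-- The explicit list of matrices over the field with `p` elements. -/
inductive IsListed (p : ℕ) (η : ZMod p) : Matrix (Fin 3) (Fin 3) (ZMod p) → Prop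
  | A1 (ν₁ ν₂ : ZMod p) (h₁ : IsOneOrEta p η ν₁) (h₂ : IsOneOrEta p η ν₂) :
      IsListed p η !![1, 0, 0; 0, ν₁, 0; 0, 0, ν₂]
  | A2 (t : ZMod p) (ht : t ≠ 0) : IsListed p η !![1, 0, 0; 0, 0, 1; 0, t, 0]
  | A3 (t : ZMod p) (ht : t ≠ 0) : IsListed p η !![0, 0, t; 0, 1, 0; 1, 0, 0]
  | A4 : IsListed p η !![0, 0, 1; 1, 0, 0; 0, 1, 0]
  | A5 : IsListed p η !![0, 1, 0; 0, 0, 1; 1, 0, 0]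
  | A6 (t : ZMod p) (ht : t ≠ 0) : IsListed p η !![0, t, 0; 1, 0, 0; 0, 0, 1]
  | B1 (ν : ZMod p) (h : IsOneOrEta p η ν) : IsListed p η !![1, 0, 0; 0, ν, 0; 0, 0, 0]
  | B2 : IsListed p η !![1, 0, 0; 0, 0, 1; 0, 0, 0]
  | B3 : IsListed p η !![0, 0, 1; 0, 1, 0; 0, 0, 0]
  | B4 : IsListed p η !![0, 1, 0; 0, 0, 1; 0, 0, 0]
  | B5 : IsListed p η !![0, 0, 1; 0, 0, 0; 0, 1, 0]
  | B6 (ν : ZMod p) (h : IsOneOrEta p η ν) : IsListed p η !![1, 0, 0; 0, 0, 0; 0, 0, ν]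
  | B7 : IsListed p η !![1, 0, 0; 0, 0, 0; 0, 1, 0]
  | B8 : IsListed p η !![0, 1, 0; 0, 0, 0; 0, 0, 1]
  | B9 : IsListed p η !![0, 0, 0; 0, 1, 0; 1, 0, 0]
  | B10 : IsListed p η !![0, 0, 0; 0, 0, 1; 1, 0, 0]
  | B11 : IsListed p η !![0, 0, 0; 1, 0, 0; 0, 0, 1]
  | B12 : IsListed p η !![0, 0, 0; 1, 0, 0; 0, 1, 0]
  | B13 : IsListed p η !![0, 1, 0; 0, 0, 0; 1, 0, 0]
  | B14 (t : ZMod p) (ht : t ≠ 0) : IsListed p η !![0, 0, t; 0, 0, 0; 1, 0, 0]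
  | B15 : IsListed p η !![0, 0, 1; 1, 0, 0; 0, 0, 0]
  | B16 (t : ZMod p) (ht : t ≠ 0) : IsListed p η !![0, t, 0; 1, 0, 0; 0, 0, 0]
  | B17 (ν : ZMod p) (h : IsOneOrEta p η ν) : IsListed p η !![0, 0, 0; 0, 1, 0; 0, 0, ν]
  | B18 (t : ZMod p) (ht : t ≠ 0) : IsListed p η !![0, 0, 0; 0, 0, 1; 0, t, 0]
  | C1 : IsListed p η !![1, 0, 0; 0, 0, 0; 0, 0, 0]
  | C2 : IsListed p η !![0, 1, 0; 0, 0, 0; 0, 0, 0]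
  | C3 : IsListed p η !![0, 0, 1; 0, 0, 0; 0, 0, 0]
  | C4 : IsListed p η !![0, 0, 0; 1, 0, 0; 0, 0, 0]
  | C5 : IsListed p η !![0, 0, 0; 0, 1, 0; 0, 0, 0]
  | C6 : IsListed p η !![0, 0, 0; 0, 0, 1; 0, 0, 0]
  | C7 : IsListed p η !![0, 0, 0; 0, 0, 0; 0, 0, 1]
  | C8 : IsListed p η !![0, 0, 0; 0, 0, 0; 0, 1, 0]
  | C9 : IsListed p η !![0, 0, 0; 0, 0, 0; 1, 0, 0]
  | C10 : IsListed p η !![0, 0, 0; 0, 0, 0; 0, 0, 0]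

/-! The classification is an orbit problem for matrices over `𝔽_p`. Write a second set of
characteristic generators as `b i ≡ ∏ a j ^ r i j` modulo `G'`. As `G'` is central of exponent `p`,
the basic commutators transform by the cofactor matrix of `R = r mod p`. Comparing orders gives `r i
j * p ^ m i = p ^ m j * s i j`, and the powers `a i ^ p ^ m i` transform by `S = s mod p`. Because
the `m i` strictly decrease, `R` is upper and `S` lower triangular; their diagonals agree and their
other entries are independent. With `L = Rᵀ`, the characteristic matrices of one group are therefore
exactly the `w'` with `det L • w' = S * w * L`; this is `Related`, justified by
`IsCharacteristicGenerators.related` and `IsCharacteristicGenerators.exists_of_related`.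

Triangular elimination in the style of the Bruhat decomposition brings every matrix to a rook matrix
(`exists_related_isRook`), and the support of the rook matrix is an invariant. What remains is the
torus action `w i j ↦ d i * d j * w i j / ∏ d k`. It preserves the ratio of two transposed entries
and the square class of the ratio of two diagonal entries, which are the parameters `t` and `ν` of
the list (`IsListed.eq_of_related`, `IsRook.exists_isListed`).

Every matrix is realised by a quotient of an explicit central extension of `ℤ³` by `𝔽_p³`
(`CrossExtension.Model`). -/

/-! ### Matrices up to lower triangular equivalence, and rook normal forms. -/

section TriangularEquivalence

variable {K : Type*} [Field K] {n : Type*}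

/-- A matrix with at most one non-zero entry in each row and in each column. -/
def IsRook (w : Matrix n n K) : Prop :=
  ∀ i j, w i j ≠ 0 → (∀ j', j' ≠ j → w i j' = 0) ∧ (∀ i', i' ≠ i → w i' j = 0)

/-- Lower triangular matrices with non-zero diagonal entries. -/
structure IsLowerUnit [LT n] (S : Matrix n n K) : Prop where
  eq_zero : ∀ i j, i < j → S i j = 0
  diag_ne : ∀ i, S i i ≠ 0

variable [Fintype n] [LinearOrder n]

theorem IsLowerUnit.mul_diag {S T : Matrix n n K} (hS : ∀ i j, i < j → S i j = 0)
    (hT : ∀ i j, i < j → T i j = 0) (i : n) : (S * T) i i = S i i * T i i := by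
  rw [Matrix.mul_apply]
  refine Finset.sum_eq_single i (fun k _ hk => ?_) (fun h => absurd (Finset.mem_univ i) h)
  rcases lt_or_gt_of_ne hk with h | h
  · rw [hT k i h, mul_zero]
  · rw [hS i k h, zero_mul]

theorem IsLowerUnit.mul {S T : Matrix n n K} (hS : IsLowerUnit S) (hT : IsLowerUnit T) :
    IsLowerUnit (S * T) where
  eq_zero i j hij := by
    rw [Matrix.mul_apply]
    refine Finset.sum_eq_zero fun k _ => ?_
    rcases lt_or_ge i k with h | h
    · rw [hS.eq_zero i k h, zero_mul]
    · rw [hT.eq_zero k j (h.trans_lt hij), mul_zero]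
  diag_ne i := by
    rw [IsLowerUnit.mul_diag hS.eq_zero hT.eq_zero]
    exact mul_ne_zero (hS.diag_ne i) (hT.diag_ne i)

theorem IsLowerUnit.det_eq {S : Matrix n n K} (hS : IsLowerUnit S) :
    S.det = ∏ i, S i i :=
  Matrix.det_of_isLowerTriangular S fun i j h => hS.eq_zero i j h

theorem IsLowerUnit.isUnit_det {S : Matrix n n K} (hS : IsLowerUnit S) : IsUnit S.det := by
  rw [hS.det_eq, isUnit_iff_ne_zero]
  exact Finset.prod_ne_zero_iff.2 fun i _ => hS.diag_ne i

theorem IsLowerUnit.exists_inv {S : Matrix n n K} (hS : IsLowerUnit S) :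
    ∃ T : Matrix n n K, IsLowerUnit T ∧ S * T = 1 ∧ T * S = 1 ∧ ∀ i, S i i * T i i = 1 := by
  have hl : ∀ i j, i < j → S⁻¹ i j = 0 := by
    have hb : S.BlockTriangular OrderDual.toDual := fun i j h => hS.eq_zero i j h
    let := S.invertibleOfIsUnitDet hS.isUnit_det
    have := Matrix.blockTriangular_inv_of_blockTriangular hb
    exact fun i j h => this h
  have h1 : S * S⁻¹ = 1 := Matrix.mul_nonsing_inv S hS.isUnit_det
  have hd : ∀ i, S i i * S⁻¹ i i = 1 := fun i => by
    rw [← IsLowerUnit.mul_diag hS.eq_zero hl, h1, Matrix.one_apply_eq]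
  exact ⟨S⁻¹, ⟨hl, fun i => right_ne_zero_of_mul_eq_one (hd i)⟩, h1,
    Matrix.nonsing_inv_mul S hS.isUnit_det, hd⟩

/-- If `w' * M = A * w` with `w'` rook and `M`, `A` lower triangular then every non-zero entry of
`w'` lies weakly below a non-zero entry of `w`. -/
theorem exists_le_of_mul_eq_mul {w w' M A : Matrix n n K} (hw' : IsRook w')
    (hM : IsLowerUnit M) (hA : IsLowerUnit A) (h : w' * M = A * w) {i j : n} (hij : w' i j ≠ 0) :
    ∃ k ≤ i, w k j ≠ 0 := by
  have h1 : (w' * M) i j = w' i j * M j j := by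
    rw [Matrix.mul_apply]
    exact Finset.sum_eq_single j (fun l _ hl => by rw [(hw' i j hij).1 l hl, zero_mul])
      (fun h => absurd (Finset.mem_univ j) h)
  by_contra! hk
  have h2 : (A * w) i j = 0 := by
    rw [Matrix.mul_apply]
    refine Finset.sum_eq_zero fun k _ => ?_
    rcases lt_or_ge i k with h | h
    · rw [hA.eq_zero i k h, zero_mul]
    · rw [hk k h, mul_zero]
  rw [h, h2] at h1
  exact mul_ne_zero hij (hM.diag_ne j) h1.symm

/-- Two rook matrices which are equivalent under lower triangular matrices from both sides differ
by the diagonal parts only. -/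
theorem rook_apply_eq {w w' S L : Matrix n n K} (hw : IsRook w) (hw' : IsRook w')
    (hS : IsLowerUnit S) (hL : IsLowerUnit L) (h : w' = S * w * L) (i j : n) :
    w' i j = S i i * w i j * L j j := by
  obtain ⟨T, hT, hST, hTS, -⟩ := hS.exists_inv
  obtain ⟨M, hM, hLM, hML, hd⟩ := hL.exists_inv
  have e1 : w' * M = S * w := by rw [h, Matrix.mul_assoc, hLM, Matrix.mul_one]
  have e2 : w * L = T * w' := by
    rw [h, ← Matrix.mul_assoc, ← Matrix.mul_assoc, hTS, Matrix.one_mul]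
  -- Going from `w'` to `w` and back moves weakly up in column `j` both times; since `w'` has only
  -- one non-zero entry in that column, neither move changes the row.
  have key : ∀ {i j}, w' i j ≠ 0 → w i j ≠ 0 := fun {i j} hij => by
    obtain ⟨k, hk, hkj⟩ := exists_le_of_mul_eq_mul hw' hM hS e1 hij
    obtain ⟨l, hl, hlj⟩ := exists_le_of_mul_eq_mul hw hL hT e2 hkj
    have hli : l = i := by
      by_contra hne
      exact hlj ((hw' i j hij).2 l hne)
    have : k = i := le_antisymm hk (hli ▸ hl)
    rwa [this] at hkj
  have key' : ∀ {i j}, w i j ≠ 0 → w' i j ≠ 0 := fun {i j} hij => by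
    obtain ⟨k, hk, hkj⟩ := exists_le_of_mul_eq_mul hw hL hT e2 hij
    obtain ⟨l, hl, hlj⟩ := exists_le_of_mul_eq_mul hw' hM hS e1 hkj
    have hli : l = i := by
      by_contra hne
      exact hlj ((hw i j hij).2 l hne)
    have : k = i := le_antisymm hk (hli ▸ hl)
    rwa [this] at hkj
  by_cases hij : w i j = 0
  · have : w' i j = 0 := by
      by_contra hne
      exact key hne hij
    rw [this, hij]; ring
  · have h1 : (w' * M) i j = w' i j * M j j := by
      rw [Matrix.mul_apply]
      exact Finset.sum_eq_single j
        (fun l _ hl => by rw [(hw' i j (key' hij)).1 l hl, zero_mul])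
        (fun h => absurd (Finset.mem_univ j) h)
    have h2 : (S * w) i j = S i i * w i j := by
      rw [Matrix.mul_apply]
      exact Finset.sum_eq_single i (fun l _ hl => by rw [(hw i j hij).2 l hl, mul_zero])
        (fun h => absurd (Finset.mem_univ i) h)
    rw [e1, h2] at h1
    rw [h1, mul_assoc, mul_comm (M j j), hd j, mul_one]

/-- The equivalence of matrices that describes the change of characteristic generators. -/
def Related (w w' : Matrix n n K) : Prop :=
  ∃ S L : Matrix n n K, IsLowerUnit S ∧ IsLowerUnit L ∧ (∀ i, S i i = L i i) ∧
    L.det • w' = S * w * L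

theorem Related.refl (w : Matrix n n K) : Related w w :=
  have h1 : IsLowerUnit (1 : Matrix n n K) :=
    ⟨fun i j h => Matrix.one_apply_ne h.ne, fun i => by simp⟩
  ⟨1, 1, h1, h1, fun _ => rfl, by simp⟩

theorem Related.trans {w w' w'' : Matrix n n K} (h : Related w w') (h' : Related w' w'') :
    Related w w'' := by
  obtain ⟨S, L, hS, hL, hd, e⟩ := h
  obtain ⟨S', L', hS', hL', hd', e'⟩ := h'
  refine ⟨S' * S, L * L', hS'.mul hS, hL.mul hL', fun i => ?_, ?_⟩
  · rw [IsLowerUnit.mul_diag hS'.eq_zero hS.eq_zero, IsLowerUnit.mul_diag hL.eq_zero hL'.eq_zero,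
      hd, hd', mul_comm]
  · rw [Matrix.det_mul, mul_smul, e', ← smul_mul_assoc, ← mul_smul_comm, e]
    simp only [Matrix.mul_assoc]

/-- On rook matrices only the torus part of the equivalence survives: `d` is the common diagonal of
`S` and `L`, and its product is `det L`. -/
theorem Related.rook_apply_eq {w w' : Matrix n n K} (h : Related w w') (hw : IsRook w)
    (hw' : IsRook w') : ∃ d : n → K, (∀ i, d i ≠ 0) ∧
      ∀ i j, (∏ k, d k) * w' i j = d i * d j * w i j := by
  obtain ⟨S, L, hS, hL, hd, e⟩ := h
  have hdet : L.det ≠ 0 := hL.isUnit_det.ne_zero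
  refine ⟨fun i => L i i, hL.diag_ne, fun i j => ?_⟩
  have hr : IsRook (L.det • w') := fun i j hij => by
    have : w' i j ≠ 0 := fun h0 => hij (by simp [h0])
    obtain ⟨h1, h2⟩ := hw' i j this
    exact ⟨fun j' hj => by simp [h1 j' hj], fun i' hi => by simp [h2 i' hi]⟩
  have := _root_.rook_apply_eq hw hr hS hL e i j
  rw [Matrix.smul_apply, smul_eq_mul, hL.det_eq, hd] at this
  rw [this]; ring

/-- Scaling by a diagonal matrix. -/
theorem related_of_diagonal {w w' : Matrix n n K} (d : n → K) (hd : ∀ i, d i ≠ 0)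
    (h : ∀ i j, (∏ k, d k) * w' i j = d i * d j * w i j) : Related w w' := by
  have hD : IsLowerUnit (Matrix.diagonal d) :=
    ⟨fun i j h => Matrix.diagonal_apply_ne d h.ne, fun i => by simpa using hd i⟩
  refine ⟨_, _, hD, hD, fun _ => rfl, ?_⟩
  ext i j
  rw [Matrix.det_diagonal, Matrix.smul_apply, smul_eq_mul, h, Matrix.mul_diagonal,
    Matrix.diagonal_mul]
  ring

/-- Clearing the column below and the row to the left of a pivot. -/
theorem exists_related_pivot (w : Matrix n n K) (i j : n) (hij : w i j ≠ 0)
    (hrow : ∀ j', j < j' → w i j' = 0) (hcol : ∀ i', i' < i → w i' j = 0) :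
    ∃ w', Related w w' ∧ w' i j ≠ 0 ∧ (∀ j', j' ≠ j → w' i j' = 0) ∧
      (∀ i', i' ≠ i → w' i' j = 0) ∧
      (∀ i' j', w i j' = 0 → w' i' j' = w i' j') ∧
      (∀ i' j', i' ≠ i → w i' j = 0 → w' i' j' = w i' j') := by
  classical
  -- `S` subtracts multiples of row `i` from the rows below it, `L` multiples of column `j` from the
  -- columns to its left. Both are unipotent, so `det L = 1`.
  let S : Matrix n n K := fun k l =>
    (if k = l then 1 else 0) - if l = i ∧ i < k then w k j / w i j else 0
  let L : Matrix n n K := fun k l =>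
    (if k = l then 1 else 0) - if k = j ∧ l < j then w i l / w i j else 0
  have hS : IsLowerUnit S := by
    refine ⟨fun k l h => ?_, fun k => ?_⟩
    · have : ¬ (l = i ∧ i < k) := fun h' => lt_asymm h (h'.1 ▸ h'.2)
      simp [S, h.ne, this]
    · have : ¬ (k = i ∧ i < k) := fun h' => h'.2.ne' h'.1
      simp [S, this]
  have hL : IsLowerUnit L := by
    refine ⟨fun k l h => ?_, fun k => ?_⟩
    · have : ¬ (k = j ∧ l < j) := fun h' => lt_asymm h (h'.1 ▸ h'.2)
      simp [L, h.ne, this]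
    · have : ¬ (k = j ∧ k < j) := fun h' => h'.2.ne h'.1
      simp [L, this]
  have hS1 : ∀ k, S k k = 1 := fun k => by
    have : ¬ (k = i ∧ i < k) := fun h' => h'.2.ne' h'.1
    simp [S, this]
  have hL1 : ∀ k, L k k = 1 := fun k => by
    have : ¬ (k = j ∧ k < j) := fun h' => h'.2.ne h'.1
    simp [L, this]
  have hSw : ∀ k l, (S * w) k l = w k l - if i < k then w k j / w i j * w i l else 0 := by
    intro k l
    rw [Matrix.mul_apply]
    simp only [S, sub_mul, Finset.sum_sub_distrib, ite_mul, one_mul, zero_mul, ite_and]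
    simp
  have hSwL : ∀ k l, (S * w * L) k l =
      (S * w) k l - if l < j then (S * w) k j * (w i l / w i j) else 0 := by
    intro k l
    rw [Matrix.mul_apply]
    simp only [L, mul_sub, Finset.sum_sub_distrib, mul_ite, mul_one, mul_zero, ite_and]
    simp
  have hSj : ∀ k, k ≠ i → (S * w) k j = 0 := fun k hk => by
    rw [hSw]
    rcases lt_or_gt_of_ne hk with h | h
    · simp [hcol k h]
    · simp [h, hij]
  have hSi : ∀ l, (S * w) i l = w i l := fun l => by simp [hSw]
  have hf : ∀ k l, k ≠ i → (S * w * L) k l = (S * w) k l := fun k l hk => by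
    simp [hSwL, hSj k hk]
  refine ⟨S * w * L, ⟨S, L, hS, hL, fun k => by rw [hS1, hL1], ?_⟩, ?_, ?_, ?_, ?_, ?_⟩
  · rw [hL.det_eq]; simp [hL1]
  · simp [hSwL, hSi, hij]
  · intro l hl
    rw [hSwL, hSi, hSi]
    rcases lt_or_gt_of_ne hl with h | h
    · rw [if_pos h]; field_simp; simp
    · simp [hrow l h]
  · intro k hk
    rw [hf k j hk, hSj k hk]
  · intro k l hl
    by_cases hk : k = i
    · subst hk; rw [hSwL, hSi, hSi, hl]; simp
    · rw [hf k l hk, hSw, hl]; simp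
  · intro k l hki hk
    rw [hf k l hki, hSw, hk]; simp

/-- Gaussian elimination from the top row down. Column operations only act leftwards, so the pivot
of a row has to be its rightmost non-zero entry. -/
theorem exists_related_isRook {n : ℕ} (w : Matrix (Fin n) (Fin n) K) :
    ∃ w', Related w w' ∧ IsRook w' := by
  classical
  -- The invariant: non-zero entries of the first `k` rows are alone in their row and in their whole
  -- column, including the rows not yet treated.
  suffices h : ∀ k ≤ n, ∃ w', Related w w' ∧ ∀ i j, i.val < k → w' i j ≠ 0 →
      (∀ j', j' ≠ j → w' i j' = 0) ∧ (∀ i', i' ≠ i → w' i' j = 0) by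
    obtain ⟨w', h, h'⟩ := h n le_rfl
    exact ⟨w', h, fun i j => h' i j i.2⟩
  intro k
  induction k with
  | zero => exact fun _ => ⟨w, Related.refl w, fun i j hi => absurd hi (Nat.not_lt_zero _)⟩
  | succ k ih =>
    intro hk
    obtain ⟨u, hu, hc⟩ := ih (Nat.le_of_succ_le hk)
    let i : Fin n := ⟨k, hk⟩
    by_cases h0 : ∀ j, u i j = 0
    · refine ⟨u, hu, fun i' j hi hne => ?_⟩
      rcases Nat.lt_succ_iff_lt_or_eq.1 hi with h | h
      · exact hc i' j h hne
      · exact absurd (h0 j) ((Fin.ext h : i' = i) ▸ hne)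
    · obtain ⟨j, hj, hmax⟩ : ∃ j, u i j ≠ 0 ∧ ∀ j', j < j' → u i j' = 0 := by
        have hne : (Finset.univ.filter fun j => u i j ≠ 0).Nonempty := by
          push Not at h0
          obtain ⟨j, hj⟩ := h0
          exact ⟨j, by simpa using hj⟩
        refine ⟨_, (Finset.mem_filter.1 (Finset.max'_mem _ hne)).2, fun j' hj' => ?_⟩
        by_contra hne'
        exact (Finset.le_max' _ j' (by simpa using hne')).not_gt hj'
      -- A non-zero entry above would be an earlier pivot, whose column is already cleared in row
      -- `i`.
      have hcol : ∀ i', i' < i → u i' j = 0 := fun i' hi' => by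
        by_contra hne
        exact hj ((hc i' j hi' hne).2 i hi'.ne')
      obtain ⟨v, huv, hv, hvr, hvc, hv1, hv2⟩ := exists_related_pivot u i j hj hmax hcol
      refine ⟨v, hu.trans huv, fun i' j' hi hne => ?_⟩
      rcases Nat.lt_succ_iff_lt_or_eq.1 hi with h | h
      · have hii : i' ≠ i := fun e => h.ne (congrArg Fin.val e)
        have e : ∀ l, v i' l = u i' l := fun l => hv2 i' l hii (hcol i' h)
        rw [e] at hne
        obtain ⟨h1, h2⟩ := hc i' j' h hne
        exact ⟨fun l hl => by rw [e, h1 l hl],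
          fun l hl => by rw [hv1 l j' (h2 i hii.symm), h2 l hl]⟩
      · obtain rfl : i' = i := Fin.ext h
        have : j' = j := by
          by_contra hne'
          exact hne (hvr j' hne')
        subst this
        exact ⟨hvr, hvc⟩

end TriangularEquivalence

/-! ### The list as a set of representatives of the equivalence classes. -/

section Listed

variable {p : ℕ} [Fact p.Prime] {η : ZMod p}

theorem isRook_fin_three {K : Type*} [Field K] {a b c d e f g h i : K}
    (hr : (a * b = 0 ∧ a * c = 0 ∧ b * c = 0) ∧ (d * e = 0 ∧ d * f = 0 ∧ e * f = 0) ∧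
      (g * h = 0 ∧ g * i = 0 ∧ h * i = 0))
    (hc : (a * d = 0 ∧ a * g = 0 ∧ d * g = 0) ∧ (b * e = 0 ∧ b * h = 0 ∧ e * h = 0) ∧
      (c * f = 0 ∧ c * i = 0 ∧ f * i = 0)) : IsRook !![a, b, c; d, e, f; g, h, i] := by
  intro j k
  simp only [mul_eq_zero] at hr hc
  fin_cases j <;> fin_cases k <;> simp [Fin.forall_fin_succ] <;> grind

theorem IsListed.isRook {w : Matrix (Fin 3) (Fin 3) (ZMod p)} (h : IsListed p η w) :
    IsRook w := by
  cases h <;> exact isRook_fin_three (by simp) (by simp)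

/-- The normalization of the non-zero entries of the listed matrices. -/
theorem IsListed.entries {w : Matrix (Fin 3) (Fin 3) (ZMod p)} (h : IsListed p η w) :
    (w 0 0 = 0 ∨ w 0 0 = 1) ∧ (w 0 1 = 0 ∨ w 1 0 = 1 ∨ w 0 1 = 1 ∧ w 1 0 = 0) ∧
    (w 0 2 = 0 ∨ w 2 0 = 1 ∨ w 0 2 = 1 ∧ w 2 0 = 0) ∧ (w 1 0 = 0 ∨ w 1 0 = 1) ∧
    (w 1 1 = 0 ∨ w 1 1 = 1 ∨ p ≠ 2 ∧ w 1 1 = η ∧ w 0 0 = 1) ∧ (w 1 2 = 0 ∨ w 1 2 = 1) ∧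
    (w 2 0 = 0 ∨ w 2 0 = 1) ∧ (w 2 1 = 0 ∨ w 1 2 = 1 ∨ w 2 1 = 1 ∧ w 1 2 = 0) ∧
    (w 2 2 = 0 ∨ w 2 2 = 1 ∨ p ≠ 2 ∧ w 2 2 = η ∧ (w 0 0 = 1 ∨ w 1 1 = 1)) := by
  cases h
  case A1 ν₁ ν₂ h₁ h₂ =>
    rcases h₁ with rfl | ⟨hp, rfl⟩ <;> rcases h₂ with rfl | ⟨hp', rfl⟩ <;> simp [*]
  case B1 ν h => rcases h with rfl | ⟨hp, rfl⟩ <;> simp [*]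
  case B6 ν h => rcases h with rfl | ⟨hp, rfl⟩ <;> simp [*]
  case B17 ν h => rcases h with rfl | ⟨hp, rfl⟩ <;> simp [*]
  all_goals simp

/-- The factor `d i * d j / ∏ d k` is symmetric in `i` and `j`, so ratios of transposed entries are
fixed; ratios of diagonal entries change by the square `(d i / d j) ^ 2`. With the support fixed,
the normalization in `IsListed.entries` leaves no freedom. -/
theorem IsListed.eq_of_related (hη : p ≠ 2 → ¬ IsSquare η)
    {w w' : Matrix (Fin 3) (Fin 3) (ZMod p)} (h : IsListed p η w) (h' : IsListed p η w')
    (hr : Related w w') : w' = w := by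
  obtain ⟨d, hd, e⟩ := hr.rook_apply_eq h.isRook h'.isRook
  obtain ⟨a00, a01, a02, a10, a11, a12, a20, a21, a22⟩ := h.entries
  obtain ⟨b00, b01, b02, b10, b11, b12, b20, b21, b22⟩ := h'.entries
  have hδ : ∏ k, d k ≠ 0 := Finset.prod_ne_zero_iff.2 fun k _ => hd k
  have hz : ∀ i j, w' i j = 0 ↔ w i j = 0 := fun i j => by
    have := e i j
    constructor
    · intro h; rw [h, mul_zero] at this
      simpa [hd i, hd j] using this.symm
    · intro h; rw [h, mul_zero] at this
      simpa [hδ] using this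
  have hsq : ∀ x y : ZMod p, y ≠ 0 → x * x = y * y * η → p = 2 := fun x y hy hxy => by
    by_contra hp
    refine hη hp ⟨x / y, ?_⟩
    field_simp
    linear_combination -hxy
  -- Equal entries `1` at `(i, i)` force `∏ d k = d i ^ 2`, so the entries at `(j, j)` differ by a
  -- square, which cannot turn `1` into `η`.
  have diag : ∀ i j, w i i = 1 → w' i i = 1 → w' j j ≠ 0 →
      (w j j = 0 ∨ w j j = 1 ∨ p ≠ 2 ∧ w j j = η) →
      (w' j j = 0 ∨ w' j j = 1 ∨ p ≠ 2 ∧ w' j j = η) → w' j j = w j j := by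
    intro i j hi hi' hj hw hw'
    have hj0 : w j j ≠ 0 := fun h0 => hj ((hz j j).2 h0)
    have e1 := e i i
    have e2 := e j j
    rw [hi, hi', mul_one, mul_one] at e1
    rw [e1] at e2
    rcases hw with hw | hw | ⟨hp, hw⟩
    · exact absurd hw hj0
    · rcases hw' with hw' | hw' | ⟨hp, hw'⟩
      · exact absurd hw' hj
      · rw [hw, hw']
      · rw [hw, hw', mul_one] at e2
        exact absurd (hsq _ _ (hd i) e2.symm) hp
    · rcases hw' with hw' | hw' | ⟨hp, hw'⟩
      · exact absurd hw' hj
      · rw [hw, hw', mul_one] at e2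
        exact absurd (hsq _ _ (hd j) e2) hp
      · rw [hw, hw']
  have anti : ∀ i j, w' j i = w j i → (w i j = 0 ∨ w j i = 1 ∨ w i j = 1 ∧ w j i = 0) →
      (w' i j = 0 ∨ w' j i = 1 ∨ w' i j = 1 ∧ w' j i = 0) → w' i j = w i j := by
    intro i j hji hw hw'
    by_cases h1 : w j i = 1
    · have e1 := e i j
      have e2 := e j i
      rw [hji, h1, mul_one, mul_one] at e2
      rw [e2, mul_comm (d j)] at e1
      exact mul_left_cancel₀ (mul_ne_zero (hd i) (hd j)) e1
    · have := hz i j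
      rw [hji] at hw'
      rcases hw with hw | hw | hw
      · rw [hw, this.2 hw]
      · exact absurd hw h1
      · rcases hw' with hw' | hw' | hw'
        · rw [hw', this.1 hw']
        · exact absurd hw' h1
        · rw [hw.1, hw'.1]
  have unit : ∀ i j, (w i j = 0 ∨ w i j = 1) → (w' i j = 0 ∨ w' i j = 1) → w' i j = w i j := by
    intro i j hw hw'
    have := hz i j
    rcases hw with hw | hw
    · rw [hw, this.2 hw]
    · rcases hw' with hw' | hw'
      · rw [hw', this.1 hw']
      · rw [hw, hw']
  have c00 := unit 0 0 a00 b00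
  have c10 := unit 1 0 a10 b10
  have c12 := unit 1 2 a12 b12
  have c20 := unit 2 0 a20 b20
  have c01 := anti 0 1 c10 a01 b01
  have c02 := anti 0 2 c20 a02 b02
  have c21 := anti 2 1 c12 a21 b21
  have w11 : w 1 1 = 0 ∨ w 1 1 = 1 ∨ p ≠ 2 ∧ w 1 1 = η :=
    a11.imp_right (Or.imp_right fun h => ⟨h.1, h.2.1⟩)
  have w11' : w' 1 1 = 0 ∨ w' 1 1 = 1 ∨ p ≠ 2 ∧ w' 1 1 = η :=
    b11.imp_right (Or.imp_right fun h => ⟨h.1, h.2.1⟩)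
  have w22 : w 2 2 = 0 ∨ w 2 2 = 1 ∨ p ≠ 2 ∧ w 2 2 = η :=
    a22.imp_right (Or.imp_right fun h => ⟨h.1, h.2.1⟩)
  have w22' : w' 2 2 = 0 ∨ w' 2 2 = 1 ∨ p ≠ 2 ∧ w' 2 2 = η :=
    b22.imp_right (Or.imp_right fun h => ⟨h.1, h.2.1⟩)
  have c11 : w' 1 1 = w 1 1 := by
    by_cases h0 : w' 1 1 = 0
    · rw [h0, (hz 1 1).1 h0]
    by_cases h1 : w 0 0 = 1
    · exact diag 0 1 h1 (c00.trans h1) h0 w11 w11'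
    -- The value `η` occurs on the diagonal only after an earlier diagonal entry `1`, so here the
    -- entry is `0` or `1`.
    · exact unit 1 1 (a11.imp_right fun h => h.resolve_right fun h => h1 h.2.2)
        (b11.imp_right fun h => h.resolve_right fun h => h1 (c00 ▸ h.2.2))
  have c22 : w' 2 2 = w 2 2 := by
    by_cases h0 : w' 2 2 = 0
    · rw [h0, (hz 2 2).1 h0]
    by_cases h1 : w 0 0 = 1
    · exact diag 0 2 h1 (c00.trans h1) h0 w22 w22'
    by_cases h2 : w 1 1 = 1
    · exact diag 1 2 h2 (c11.trans h2) h0 w22 w22'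
    · exact unit 2 2 (a22.imp_right fun h => h.resolve_right fun h => h.2.2.elim h1 h2)
        (b22.imp_right fun h => h.resolve_right fun h =>
          h.2.2.elim (fun h => h1 (c00 ▸ h)) fun h => h2 (c11 ▸ h))
  rw [Matrix.eta_fin_three w, Matrix.eta_fin_three w', c00, c01, c02, c10, c11, c12, c20, c21, c22]

theorem IsOneOrEta.ne_zero (hη : p ≠ 2 → ¬ IsSquare η) {ν : ZMod p} (h : IsOneOrEta p η ν) :
    ν ≠ 0 := by
  rcases h with rfl | ⟨hp, rfl⟩
  · exact one_ne_zero
  · rintro rfl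
    exact hη hp (IsSquare.zero)

/-- The product of two non-squares is a square, so `1` and `η` represent all square classes; for `p
= 2` every element is a square. -/
theorem exists_isOneOrEta_mul_sq (hη : p ≠ 2 → ¬ IsSquare η) {x : ZMod p} (hx : x ≠ 0) :
    ∃ ν d : ZMod p, IsOneOrEta p η ν ∧ d ≠ 0 ∧ x = ν * d ^ 2 := by
  classical
  by_cases h : IsSquare x
  · obtain ⟨d, rfl⟩ := h
    exact ⟨1, d, Or.inl rfl, fun h => hx (by simp [h]), by ring⟩
  · have hp : p ≠ 2 := fun hp =>
      h (FiniteField.isSquare_of_char_two (by rw [ZMod.ringChar_zmod_n, hp]) x)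
    have hη0 : η ≠ 0 := IsOneOrEta.ne_zero hη (Or.inr ⟨hp, rfl⟩)
    have h1 : IsSquare (x * η) := by
      rw [← quadraticChar_one_iff_isSquare (mul_ne_zero hx hη0), map_mul,
        quadraticChar_neg_one_iff_not_isSquare.2 h,
        quadraticChar_neg_one_iff_not_isSquare.2 (hη hp)]
      rfl
    obtain ⟨d, hd⟩ := h1
    refine ⟨η, d / η, Or.inr ⟨hp, rfl⟩, div_ne_zero ?_ hη0, ?_⟩
    · rintro rfl
      simp [hx, hη0] at hd
    · field_simp
      linear_combination hd

/-- The equations `a * b * c * w' i j = d i * d j * w i j` for `d = (a, b, c)`, with common factors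
cancelled so that suitable scalars can be read off. -/
theorem related_fin_three {K : Type*} [Field K] {w w' : Matrix (Fin 3) (Fin 3) K} (a b c : K)
    (ha : a ≠ 0) (hb : b ≠ 0) (hc : c ≠ 0)
    (h0 : b * c * w' 0 0 = a * w 0 0 ∧ c * w' 0 1 = w 0 1 ∧ b * w' 0 2 = w 0 2)
    (h1 : c * w' 1 0 = w 1 0 ∧ a * c * w' 1 1 = b * w 1 1 ∧ a * w' 1 2 = w 1 2)
    (h2 : b * w' 2 0 = w 2 0 ∧ a * w' 2 1 = w 2 1 ∧ a * b * w' 2 2 = c * w 2 2) :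
    Related w w' := by
  refine related_of_diagonal ![a, b, c] (fun i => by fin_cases i <;> assumption) ?_
  intro i j
  obtain ⟨e0, e1, e2⟩ := h0
  obtain ⟨e3, e4, e5⟩ := h1
  obtain ⟨e6, e7, e8⟩ := h2
  fin_cases i <;> fin_cases j <;> simp [Fin.prod_univ_three]
  · linear_combination a * e0
  · linear_combination a * b * e1
  · linear_combination a * c * e2
  · linear_combination a * b * e3
  · linear_combination b * e4
  · linear_combination b * c * e5
  · linear_combination a * c * e6
  · linear_combination b * c * e7
  · linear_combination c * e8

set_option linter.unusedSimpArgs false in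
/-- Every rook matrix over the field with `p` elements is equivalent to a listed one. -/
theorem IsRook.exists_isListed (hη : p ≠ 2 → ¬ IsSquare η)
    {w : Matrix (Fin 3) (Fin 3) (ZMod p)} (hw : IsRook w) :
    ∃ w', IsListed p η w' ∧ Related w w' := by
  have row : ∀ i, (w i 0 = 0 ∧ w i 1 = 0 ∧ w i 2 = 0) ∨
      (w i 0 ≠ 0 ∧ w i 1 = 0 ∧ w i 2 = 0 ∧ ∀ i', i' ≠ i → w i' 0 = 0) ∨
      (w i 0 = 0 ∧ w i 1 ≠ 0 ∧ w i 2 = 0 ∧ ∀ i', i' ≠ i → w i' 1 = 0) ∨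
      (w i 0 = 0 ∧ w i 1 = 0 ∧ w i 2 ≠ 0 ∧ ∀ i', i' ≠ i → w i' 2 = 0) := by
    intro i
    by_cases h0 : w i 0 = 0
    · by_cases h1 : w i 1 = 0
      · by_cases h2 : w i 2 = 0
        · exact Or.inl ⟨h0, h1, h2⟩
        · exact Or.inr (Or.inr (Or.inr ⟨h0, h1, h2, (hw i 2 h2).2⟩))
      · obtain ⟨hr, hc⟩ := hw i 1 h1
        exact Or.inr (Or.inr (Or.inl ⟨h0, h1, hr 2 (by decide), hc⟩))
    · obtain ⟨hr, hc⟩ := hw i 0 h0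
      exact Or.inr (Or.inl ⟨h0, hr 1 (by decide), hr 2 (by decide), hc⟩)
  -- Of the 64 combinations, those with two pivots in one column are contradictory; the remaining 34
  -- are the rook placements on a 3 × 3 board.
  rcases row 0 with ⟨a0, a1, a2⟩ | ⟨a0, a1, a2, ac⟩ | ⟨a0, a1, a2, ac⟩ | ⟨a0, a1, a2, ac⟩ <;>
  rcases row 1 with ⟨b0, b1, b2⟩ | ⟨b0, b1, b2, bc⟩ | ⟨b0, b1, b2, bc⟩ | ⟨b0, b1, b2, bc⟩ <;>
  rcases row 2 with ⟨c0, c1, c2⟩ | ⟨c0, c1, c2, cc⟩ | ⟨c0, c1, c2, cc⟩ | ⟨c0, c1, c2, cc⟩ <;>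
  first
    | exact absurd (ac 1 (by decide)) ‹_›
    | exact absurd (ac 2 (by decide)) ‹_›
    | exact absurd (bc 2 (by decide)) ‹_›
    | skip
  · refine ⟨_, .C10, related_fin_three 1 1 1
      one_ne_zero one_ne_zero one_ne_zero ?_ ?_ ?_⟩ <;>
      simp [a0, a1, a2, b0, b1, b2, c0, c1, c2]
  · refine ⟨_, .C9, related_fin_three 1 (w 2 0) 1
      one_ne_zero c0 one_ne_zero ?_ ?_ ?_⟩ <;>
      simp [a0, a1, a2, b0, b1, b2, c0, c1, c2]
  · refine ⟨_, .C8, related_fin_three (w 2 1) 1 1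
      c1 one_ne_zero one_ne_zero ?_ ?_ ?_⟩ <;>
      simp [a0, a1, a2, b0, b1, b2, c0, c1, c2]
  · refine ⟨_, .C7, related_fin_three 1 (w 2 2) 1
      one_ne_zero c2 one_ne_zero ?_ ?_ ?_⟩ <;>
      simp [a0, a1, a2, b0, b1, b2, c0, c1, c2]
  · refine ⟨_, .C4, related_fin_three 1 1 (w 1 0)
      one_ne_zero one_ne_zero b0 ?_ ?_ ?_⟩ <;>
      simp [a0, a1, a2, b0, b1, b2, c0, c1, c2]
  · refine ⟨_, .B12, related_fin_three (w 2 1) 1 (w 1 0)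
      c1 one_ne_zero b0 ?_ ?_ ?_⟩ <;>
      simp [a0, a1, a2, b0, b1, b2, c0, c1, c2]
  · refine ⟨_, .B11, related_fin_three 1 (w 1 0 * w 2 2) (w 1 0)
      one_ne_zero (mul_ne_zero b0 c2) b0 ?_ ?_ ?_⟩ <;>
      simp [a0, a1, a2, b0, b1, b2, c0, c1, c2]
  · refine ⟨_, .C5, related_fin_three 1 1 (w 1 1)
      one_ne_zero one_ne_zero b1 ?_ ?_ ?_⟩ <;>
      simp [a0, a1, a2, b0, b1, b2, c0, c1, c2]
  · refine ⟨_, .B9, related_fin_three 1 (w 2 0) (w 1 1 * w 2 0)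
      one_ne_zero c0 (mul_ne_zero b1 c0) ?_ ?_ ?_⟩ <;>
      simp [a0, a1, a2, b0, b1, b2, c0, c1, c2] <;> field_simp
  -- The product of the two diagonal entries has the square class of their ratio, the invariant that
  -- `ν` records.
  · obtain ⟨ν, e, hν, he, h⟩ := exists_isOneOrEta_mul_sq hη (mul_ne_zero b1 c2)
    refine ⟨_, .B17 ν hν, related_fin_three e 1 (w 1 1 / e)
      he one_ne_zero (div_ne_zero b1 he) ?_ ?_ ?_⟩ <;>
      simp [a0, a1, a2, b0, b1, b2, c0, c1, c2] <;> field_simp <;> grind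
  · refine ⟨_, .C6, related_fin_three (w 1 2) 1 1
      b2 one_ne_zero one_ne_zero ?_ ?_ ?_⟩ <;>
      simp [a0, a1, a2, b0, b1, b2, c0, c1, c2]
  · refine ⟨_, .B10, related_fin_three (w 1 2) (w 2 0) 1
      b2 c0 one_ne_zero ?_ ?_ ?_⟩ <;>
      simp [a0, a1, a2, b0, b1, b2, c0, c1, c2]
  -- The parameter has to be the invariant ratio of the two transposed entries, since one of them is
  -- scaled to `1`.
  · refine ⟨_, .B18 (w 2 1 / w 1 2) (div_ne_zero c1 b2), related_fin_three (w 1 2) 1 1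
      b2 one_ne_zero one_ne_zero ?_ ?_ ?_⟩ <;>
      simp [a0, a1, a2, b0, b1, b2, c0, c1, c2] <;> field_simp
  · refine ⟨_, .C1, related_fin_three 1 1 (w 0 0)
      one_ne_zero one_ne_zero a0 ?_ ?_ ?_⟩ <;>
      simp [a0, a1, a2, b0, b1, b2, c0, c1, c2]
  · refine ⟨_, .B7, related_fin_three (w 2 1) 1 (w 0 0 * w 2 1)
      c1 one_ne_zero (mul_ne_zero a0 c1) ?_ ?_ ?_⟩ <;>
      simp [a0, a1, a2, b0, b1, b2, c0, c1, c2] <;> field_simp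
  · obtain ⟨ν, e, hν, he, h⟩ := exists_isOneOrEta_mul_sq hη (mul_ne_zero a0 c2)
    refine ⟨_, .B6 ν hν, related_fin_three (e / w 0 0) e 1
      (div_ne_zero he a0) he one_ne_zero ?_ ?_ ?_⟩ <;>
      simp [a0, a1, a2, b0, b1, b2, c0, c1, c2] <;> field_simp <;> grind
  · obtain ⟨ν, e, hν, he, h⟩ := exists_isOneOrEta_mul_sq hη (mul_ne_zero a0 b1)
    refine ⟨_, .B1 ν hν, related_fin_three (e / w 0 0) 1 e
      (div_ne_zero he a0) one_ne_zero he ?_ ?_ ?_⟩ <;>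
      simp [a0, a1, a2, b0, b1, b2, c0, c1, c2] <;> field_simp <;> grind
  · obtain ⟨ν, e, hν, he, h⟩ := exists_isOneOrEta_mul_sq hη (mul_ne_zero a0 b1)
    obtain ⟨ν', f, hν', hf, h'⟩ := exists_isOneOrEta_mul_sq hη (mul_ne_zero a0 c2)
    refine ⟨_, .A1 ν ν' hν hν', related_fin_three (f * e / w 0 0) f e
      (div_ne_zero (mul_ne_zero hf he) a0) hf he ?_ ?_ ?_⟩ <;>
      simp [a0, a1, a2, b0, b1, b2, c0, c1, c2] <;> field_simp <;> grind
  · refine ⟨_, .B2, related_fin_three (w 1 2) 1 (w 0 0 * w 1 2)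
      b2 one_ne_zero (mul_ne_zero a0 b2) ?_ ?_ ?_⟩ <;>
      simp [a0, a1, a2, b0, b1, b2, c0, c1, c2] <;> field_simp
  · refine ⟨_, .A2 (w 2 1 / w 1 2) (div_ne_zero c1 b2), related_fin_three (w 1 2) 1 (w 0 0 * w 1 2)
      b2 one_ne_zero (mul_ne_zero a0 b2) ?_ ?_ ?_⟩ <;>
      simp [a0, a1, a2, b0, b1, b2, c0, c1, c2] <;> field_simp
  · refine ⟨_, .C2, related_fin_three 1 1 (w 0 1)
      one_ne_zero one_ne_zero a1 ?_ ?_ ?_⟩ <;>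
      simp [a0, a1, a2, b0, b1, b2, c0, c1, c2]
  · refine ⟨_, .B13, related_fin_three 1 (w 2 0) (w 0 1)
      one_ne_zero c0 a1 ?_ ?_ ?_⟩ <;>
      simp [a0, a1, a2, b0, b1, b2, c0, c1, c2]
  · refine ⟨_, .B8, related_fin_three 1 (w 0 1 * w 2 2) (w 0 1)
      one_ne_zero (mul_ne_zero a1 c2) a1 ?_ ?_ ?_⟩ <;>
      simp [a0, a1, a2, b0, b1, b2, c0, c1, c2]
  · refine ⟨_, .B16 (w 0 1 / w 1 0) (div_ne_zero a1 b0), related_fin_three 1 1 (w 1 0)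
      one_ne_zero one_ne_zero b0 ?_ ?_ ?_⟩ <;>
      simp [a0, a1, a2, b0, b1, b2, c0, c1, c2] <;> field_simp
  · refine ⟨_, .A6 (w 0 1 / w 1 0) (div_ne_zero a1 b0), related_fin_three 1 (w 1 0 * w 2 2) (w 1 0)
      one_ne_zero (mul_ne_zero b0 c2) b0 ?_ ?_ ?_⟩ <;>
      simp [a0, a1, a2, b0, b1, b2, c0, c1, c2] <;> field_simp
  · refine ⟨_, .B4, related_fin_three (w 1 2) 1 (w 0 1)
      b2 one_ne_zero a1 ?_ ?_ ?_⟩ <;>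
      simp [a0, a1, a2, b0, b1, b2, c0, c1, c2]
  · refine ⟨_, .A5, related_fin_three (w 1 2) (w 2 0) (w 0 1)
      b2 c0 a1 ?_ ?_ ?_⟩ <;>
      simp [a0, a1, a2, b0, b1, b2, c0, c1, c2]
  · refine ⟨_, .C3, related_fin_three 1 (w 0 2) 1
      one_ne_zero a2 one_ne_zero ?_ ?_ ?_⟩ <;>
      simp [a0, a1, a2, b0, b1, b2, c0, c1, c2]
  · refine ⟨_, .B14 (w 0 2 / w 2 0) (div_ne_zero a2 c0), related_fin_three 1 (w 2 0) 1
      one_ne_zero c0 one_ne_zero ?_ ?_ ?_⟩ <;>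
      simp [a0, a1, a2, b0, b1, b2, c0, c1, c2] <;> field_simp
  · refine ⟨_, .B5, related_fin_three (w 2 1) (w 0 2) 1
      c1 a2 one_ne_zero ?_ ?_ ?_⟩ <;>
      simp [a0, a1, a2, b0, b1, b2, c0, c1, c2]
  · refine ⟨_, .B15, related_fin_three 1 (w 0 2) (w 1 0)
      one_ne_zero a2 b0 ?_ ?_ ?_⟩ <;>
      simp [a0, a1, a2, b0, b1, b2, c0, c1, c2]
  · refine ⟨_, .A4, related_fin_three (w 2 1) (w 0 2) (w 1 0)
      c1 a2 b0 ?_ ?_ ?_⟩ <;>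
      simp [a0, a1, a2, b0, b1, b2, c0, c1, c2]
  · refine ⟨_, .B3, related_fin_three 1 (w 0 2) (w 0 2 * w 1 1)
      one_ne_zero a2 (mul_ne_zero a2 b1) ?_ ?_ ?_⟩ <;>
      simp [a0, a1, a2, b0, b1, b2, c0, c1, c2]
  · refine ⟨_, .A3 (w 0 2 / w 2 0) (div_ne_zero a2 c0), related_fin_three 1 (w 2 0) (w 1 1 * w 2 0)
      one_ne_zero c0 (mul_ne_zero b1 c0) ?_ ?_ ?_⟩ <;>
      simp [a0, a1, a2, b0, b1, b2, c0, c1, c2] <;> field_simp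

theorem exists_isListed_related (hη : p ≠ 2 → ¬ IsSquare η) (w : Matrix (Fin 3) (Fin 3) (ZMod p)) :
    ∃ w', IsListed p η w' ∧ Related w w' := by
  obtain ⟨u, hu, hr⟩ := exists_related_isRook w
  obtain ⟨w', hw', h⟩ := hr.exists_isListed hη
  exact ⟨w', hw', hu.trans h⟩

end Listed

/-! ### The Frattini hypothesis gives class at most two. -/

section Frattini

variable {p : ℕ} [Fact p.Prime] {G : Type*} [Group G] [Finite G]

/-- A maximal subgroup of a finite `p`-group is normal with simple nilpotent, hence cyclic,
quotient, so it contains all commutators. -/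
theorem IsPGroup.commutator_le_frattini (hG : IsPGroup p G) : commutator G ≤ frattini G := by
  have : Group.IsNilpotent G := hG.isNilpotent
  rw [frattini, Order.radical]
  refine le_iInf₂ fun M hM => ?_
  have hM' : IsCoatom M := hM
  have hn : M.Normal :=
    Subgroup.NormalizerCondition.normal_of_coatom M Group.normalizerCondition_of_isNilpotent hM'
  have hs : IsSimpleGroup (G ⧸ M) := by
    have : Nontrivial (G ⧸ M) := QuotientGroup.nontrivial_iff.2 hM'.1
    refine ⟨fun H _ => ?_⟩
    have hle : M ≤ H.comap (QuotientGroup.mk' M) := by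
      intro x hx
      have : QuotientGroup.mk' M x = 1 := (QuotientGroup.eq_one_iff x).2 hx
      rw [Subgroup.mem_comap, this]
      exact H.one_mem
    have hsurj := QuotientGroup.mk'_surjective M
    rcases hle.eq_or_lt with h | h
    · left
      rw [← Subgroup.map_comap_eq_self_of_surjective hsurj H, ← h]
      simp
    · right
      rw [← Subgroup.map_comap_eq_self_of_surjective hsurj H, hM'.2 _ h]
      exact Subgroup.map_top_of_surjective _ hsurj
  have hcomm : ∀ x y : G ⧸ M, x * y = y * x := by
    have : IsCyclic (G ⧸ M) := inferInstance
    obtain ⟨g, hg⟩ := this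
    intro x y
    obtain ⟨i, rfl⟩ := hg x
    obtain ⟨j, rfl⟩ := hg y
    exact ((Commute.refl g).zpow_zpow i j).eq
  rw [commutator_eq_closure, Subgroup.closure_le]
  rintro _ ⟨x, y, rfl⟩
  rw [SetLike.mem_coe, ← QuotientGroup.eq_one_iff]
  change QuotientGroup.mk' M ⁅x, y⁆ = 1
  rw [map_commutatorElement, commutatorElement_eq_one_iff_mul_comm]
  exact hcomm _ _

theorem IsThreeGenGroup.commutator_le_center {m : Fin 3 → ℕ} (h : IsThreeGenGroup p m G) :
    commutator G ≤ Subgroup.center G :=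
  h.isPGroup.commutator_le_frattini.trans h.frattini_le_center

end Frattini

/-! ### Commutators and powers in groups of class at most two. -/

section Bracket

variable {G : Type*} [Group G] {A : Type*} [AddCommGroup A]

/-- Collecting the factors `g` on the left, each passage of `h` over `g` costs one central
commutator, and `0 + 1 + ⋯ + (n - 1)` passages are needed. -/
theorem mul_pow_of_commutator_mem_center (hc : commutator G ≤ Subgroup.center G) (g h : G)
    (n : ℕ) : (g * h) ^ n = g ^ n * h ^ n * ⁅h, g⁆ ^ n.choose 2 := by
  have hz : ∀ x, Commute ⁅h, g⁆ x := fun x =>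
    (Subgroup.mem_center_iff.1
      (hc (Subgroup.commutator_mem_commutator (Subgroup.mem_top h) (Subgroup.mem_top g))) x).symm
  have hs : ∀ n : ℕ, h ^ n * g = g * h ^ n * ⁅h, g⁆ ^ n := by
    intro n
    induction n with
    | zero => simp
    | succ n ih =>
      have h1 : h * g = g * h * ⁅h, g⁆ := by
        rw [← (hz (g * h)).eq, commutatorElement_def]; group
      rw [pow_succ, mul_assoc, h1, ← mul_assoc, ← mul_assoc, ih, pow_succ ⁅h, g⁆,
        mul_assoc (g * h ^ n), ((hz h).pow_left n).eq]
      group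
  induction n with
  | zero => simp
  | succ n ih =>
    calc (g * h) ^ (n + 1) = g ^ n * h ^ n * ⁅h, g⁆ ^ n.choose 2 * (g * h) := by rw [pow_succ, ih]
      _ = g ^ n * (h ^ n * g) * h * ⁅h, g⁆ ^ n.choose 2 := by
        rw [mul_assoc (g ^ n * h ^ n), ((hz (g * h)).pow_left _).eq]; simp only [mul_assoc]
      _ = g ^ n * g * (h ^ n * h) * (⁅h, g⁆ ^ n * ⁅h, g⁆ ^ n.choose 2) := by
        rw [hs]; simp only [mul_assoc]; rw [((hz h).pow_left n).left_comm]
      _ = _ := by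
        rw [← pow_succ, ← pow_succ, ← pow_add, Nat.choose_succ_succ' n 1, Nat.choose_one_right]

/-- The commutator pairing of a group of nilpotency class at most two, read off in an abelian group
that is isomorphic to the derived subgroup. -/
def commutatorPairing (e : commutator G ≃* Multiplicative A) (g h : G) : A :=
  (e ⟨⁅g, h⁆,
    Subgroup.commutator_mem_commutator (Subgroup.mem_top g) (Subgroup.mem_top h)⟩).toAdd

variable (e : commutator G ≃* Multiplicative A)

theorem commutatorPairing_mul_left (hc : commutator G ≤ Subgroup.center G) (g g' h : G) :
    commutatorPairing e (g * g') h = commutatorPairing e g h + commutatorPairing e g' h := by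
  have hz : ∀ x y z : G, Commute ⁅x, y⁆ z := fun x y z =>
    (Subgroup.mem_center_iff.1
      (hc (Subgroup.commutator_mem_commutator (Subgroup.mem_top x) (Subgroup.mem_top y))) z).symm
  unfold commutatorPairing
  rw [← toAdd_mul, ← map_mul]
  congr 2
  ext
  change ⁅g * g', h⁆ = ⁅g, h⁆ * ⁅g', h⁆
  rw [commutatorElement_mul_left_eq_conj_mul, ← (hz g' h g).eq,
    mul_inv_cancel_right, (hz g' h _).eq]

@[simp]
theorem commutatorPairing_self (g : G) : commutatorPairing e g g = 0 := by
  unfold commutatorPairing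
  rw [toAdd_eq_zero, map_eq_one_iff e e.injective]
  ext
  simp

theorem commutatorPairing_swap (g h : G) :
    commutatorPairing e g h = - commutatorPairing e h g := by
  unfold commutatorPairing
  rw [← toAdd_inv, ← map_inv]
  congr 2
  ext
  simp

/-- The commutator pairing as a homomorphism on the abelianization. -/
def commutatorPairingHom (hc : commutator G ≤ Subgroup.center G) (h : G) :
    Abelianization G →* Multiplicative A :=
  Abelianization.lift
    { toFun := fun g => .ofAdd (commutatorPairing e g h)
      map_one' := by
        have := commutatorPairing_mul_left e hc 1 1 h
        rw [one_mul, left_eq_add] at this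
        rw [this, ofAdd_zero]
      map_mul' := fun g g' => by rw [commutatorPairing_mul_left e hc, ofAdd_add] }

theorem commutatorPairingHom_of (hc : commutator G ≤ Subgroup.center G) (g h : G) :
    (commutatorPairingHom e hc h (Abelianization.of g)).toAdd = commutatorPairing e g h := by
  simp [commutatorPairingHom]

theorem commutatorPairing_of_eq_prod (hc : commutator G ≤ Subgroup.center G) {ι : Type*}
    [Fintype ι] {a : ι → G} {b : G} {r : ι → ℤ}
    (hb : Abelianization.of b = ∏ j, Abelianization.of (a j) ^ r j) (h : G) :
    commutatorPairing e b h = ∑ j, r j • commutatorPairing e (a j) h := by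
  rw [← commutatorPairingHom_of e hc, hb, map_prod, toAdd_prod]
  simp [commutatorPairingHom_of]

theorem commutatorPairing_of_eq_prod_right (hc : commutator G ≤ Subgroup.center G) {ι : Type*}
    [Fintype ι] {a : ι → G} {b : G} {r : ι → ℤ}
    (hb : Abelianization.of b = ∏ j, Abelianization.of (a j) ^ r j) (h : G) :
    commutatorPairing e h b = ∑ j, r j • commutatorPairing e h (a j) := by
  rw [commutatorPairing_swap, commutatorPairing_of_eq_prod e hc hb, ← Finset.sum_neg_distrib]
  exact Finset.sum_congr rfl fun j _ => by rw [commutatorPairing_swap e h, smul_neg]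

theorem mem_center_iff_commutatorPairing (g : G) :
    g ∈ Subgroup.center G ↔ ∀ h, commutatorPairing e g h = 0 := by
  rw [Subgroup.mem_center_iff]
  refine forall_congr' fun h => ?_
  unfold commutatorPairing
  rw [toAdd_eq_zero, map_eq_one_iff e e.injective, Subtype.ext_iff, Subgroup.coe_one,
    commutatorElement_eq_one_iff_mul_comm, eq_comm]

/-- By bilinearity `[g ^ p, h] = [g, h] ^ p = 1`. -/
theorem zpow_mem_center_of_dvd (e : commutator G ≃* Multiplicative A)
    (hc : commutator G ≤ Subgroup.center G) {p : ℕ}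
    (hp : ∀ x : A, p • x = 0) (g : G) {n : ℤ} (hn : (p : ℤ) ∣ n) :
    g ^ n ∈ Subgroup.center G := by
  obtain ⟨k, rfl⟩ := hn
  rw [zpow_mul, zpow_natCast]
  refine Subgroup.zpow_mem _ ?_ _
  rw [mem_center_iff_commutatorPairing e]
  intro h
  rw [← commutatorPairingHom_of e hc, map_pow, map_pow, toAdd_pow, hp]

theorem pow_eq_one_of_mem_commutator (e : commutator G ≃* Multiplicative A)
    {p : ℕ} (hp : ∀ x : A, p • x = 0) {g : G}
    (hg : g ∈ commutator G) {n : ℕ} (hn : p ∣ n) : g ^ n = 1 := by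
  have : (⟨g, hg⟩ : commutator G) ^ n = 1 := by
    apply e.injective
    apply Multiplicative.toAdd.injective
    obtain ⟨k, rfl⟩ := hn
    rw [map_pow, pow_mul, map_one, toAdd_pow, toAdd_pow, hp, smul_zero, toAdd_one]
  simpa using congrArg Subtype.val this

theorem pow_mul_of_dvd_choose_two (e : commutator G ≃* Multiplicative A)
    (hc : commutator G ≤ Subgroup.center G) {p : ℕ}
    (hp : ∀ x : A, p • x = 0) {n : ℕ} (hn : p ∣ n.choose 2) (g h : G) :
    (g * h) ^ n = g ^ n * h ^ n := by
  rw [mul_pow_of_commutator_mem_center hc, pow_eq_one_of_mem_commutator e hp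
    (Subgroup.commutator_mem_commutator (Subgroup.mem_top h) (Subgroup.mem_top g)) hn, mul_one]

/-- The power of a product of three factors and an element of the derived subgroup. -/
theorem pow_eq_mul_mul_of_abelianization (e : commutator G ≃* Multiplicative A)
    (hc : commutator G ≤ Subgroup.center G) {p : ℕ}
    (hp : ∀ x : A, p • x = 0) {n : ℕ} (hn : p ∣ n) {a : Fin 3 → G} {b : G} {r : Fin 3 → ℤ}
    (hb : Abelianization.of b = ∏ j, Abelianization.of (a j) ^ r j)
    (h : p ∣ n.choose 2 ∨ (p : ℤ) ∣ r 0 ∧ (p : ℤ) ∣ r 1) :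
    b ^ n = a 0 ^ (r 0 * n) * (a 1 ^ (r 1 * n) * a 2 ^ (r 2 * n)) := by
  set c := (a 0 ^ r 0 * (a 1 ^ r 1 * a 2 ^ r 2))⁻¹ * b with hcdef
  have hcm : c ∈ commutator G := by
    rw [← Abelianization.ker_of, MonoidHom.mem_ker, hcdef, map_mul, hb, Fin.prod_univ_three]
    simp [mul_assoc]
  have hbc : b = a 0 ^ r 0 * (a 1 ^ r 1 * (a 2 ^ r 2 * c)) := by
    rw [hcdef]; group
  -- Either the correction `⁅y, a 0 ^ r 0⁆ ^ n.choose 2` is trivial, or the factor `a 0 ^ r 0` is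
  -- central.
  have h0 : ∀ y, (a 0 ^ r 0 * y) ^ n = (a 0 ^ r 0) ^ n * y ^ n := fun y => by
    rcases h with h | h
    · exact pow_mul_of_dvd_choose_two e hc hp h _ _
    · have hcy : Commute y (a 0 ^ r 0) :=
        Subgroup.mem_center_iff.1 (zpow_mem_center_of_dvd e hc hp (a 0) h.1) y
      exact hcy.symm.mul_pow n
  have h1 : ∀ y, (a 1 ^ r 1 * y) ^ n = (a 1 ^ r 1) ^ n * y ^ n := fun y => by
    rcases h with h | h
    · exact pow_mul_of_dvd_choose_two e hc hp h _ _
    · have hcy : Commute y (a 1 ^ r 1) :=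
        Subgroup.mem_center_iff.1 (zpow_mem_center_of_dvd e hc hp (a 1) h.2) y
      exact hcy.symm.mul_pow n
  have h2 : (a 2 ^ r 2 * c) ^ n = (a 2 ^ r 2) ^ n := by
    have hcc : Commute (a 2 ^ r 2) c := Subgroup.mem_center_iff.1 (hc hcm) _
    rw [hcc.mul_pow,
      pow_eq_one_of_mem_commutator e hp hcm hn, mul_one]
  rw [hbc, h0, h1, h2]
  simp only [zpow_mul, zpow_natCast]

end Bracket

/-! ### Commutators and powers of generators as matrices over `𝔽_p`. -/

section CharacteristicMatrix

variable {p : ℕ} [Fact p.Prime] {m : Fin 3 → ℕ} {G : Type*} [Group G]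
  (e : commutator G ≃* Multiplicative (Fin 3 → ZMod p))

/-- The rows are the coordinates of `[a 1, a 2]`, `[a 2, a 0]`, `[a 0, a 1]`. -/
def commutatorMatrix (a : Fin 3 → G) : Matrix (Fin 3) (Fin 3) (ZMod p) :=
  Matrix.of ![commutatorPairing e (a 1) (a 2), commutatorPairing e (a 2) (a 0),
    commutatorPairing e (a 0) (a 1)]

/-- The rows are the coordinates of the powers `a i ^ p ^ m i`. -/
def powerMatrix (m : Fin 3 → ℕ) {a : Fin 3 → G} (ha : ∀ i, a i ^ p ^ m i ∈ commutator G) :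
    Matrix (Fin 3) (Fin 3) (ZMod p) :=
  Matrix.of fun i => (e ⟨a i ^ p ^ m i, ha i⟩).toAdd

theorem nsmul_prime_eq_zero (x : Fin 3 → ZMod p) : p • x = 0 := by
  ext i; simp

/-- This linearises the power relations: once the commutator matrix is invertible, the generators
determine `w` as power matrix times inverse commutator matrix. -/
theorem pow_eq_iff_powerMatrix_eq {a : Fin 3 → G} (ha : ∀ i, a i ^ p ^ m i ∈ commutator G)
    (w : Matrix (Fin 3) (Fin 3) (ZMod p)) :
    (∀ i, a i ^ p ^ m i =
      ⁅a 1, a 2⁆ ^ (w i 0).val * ⁅a 2, a 0⁆ ^ (w i 1).val * ⁅a 0, a 1⁆ ^ (w i 2).val) ↔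
    powerMatrix e m ha = w * commutatorMatrix e a := by
  have hm : ∀ g h : G, ⁅g, h⁆ ∈ commutator G := fun g h =>
    Subgroup.commutator_mem_commutator (Subgroup.mem_top g) (Subgroup.mem_top h)
  have hsm : ∀ (x : ZMod p) (v : Fin 3 → ZMod p), x.val • v = x • v := fun x v => by
    rw [← Nat.cast_smul_eq_nsmul (ZMod p), ZMod.natCast_zmod_val]
  have key : ∀ i, (w * commutatorMatrix e a) i = (e (⟨_, hm (a 1) (a 2)⟩ ^ (w i 0).val *
      ⟨_, hm (a 2) (a 0)⟩ ^ (w i 1).val * ⟨_, hm (a 0) (a 1)⟩ ^ (w i 2).val)).toAdd := by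
    intro i
    rw [map_mul e, map_mul e, map_pow e, map_pow e, map_pow e, toAdd_mul, toAdd_mul, toAdd_pow, toAdd_pow,
      toAdd_pow, hsm, hsm, hsm]
    ext j
    rw [Matrix.mul_apply, Fin.sum_univ_three]
    rfl
  refine Iff.trans ?_
    (funext_iff (f := powerMatrix e m ha) (g := w * commutatorMatrix e a)).symm
  refine forall_congr' fun i => ?_
  rw [key]
  change _ ↔ (e _).toAdd = _
  rw [Multiplicative.toAdd.injective.eq_iff, e.injective.eq_iff, Subtype.ext_iff]
  rfl

/-- Generators modulo the derived subgroup have linearly independent commutators. -/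
theorem isUnit_det_commutatorMatrix (hc : commutator G ≤ Subgroup.center G) {a : Fin 3 → G}
    (ha : ∀ g : G, ∃ r : Fin 3 → ℤ, Abelianization.of g = ∏ j, Abelianization.of (a j) ^ r j) :
    IsUnit (commutatorMatrix e a).det := by
  rw [isUnit_iff_ne_zero]
  intro h0
  -- Pairing with `v` is a functional that kills the basic commutators, hence by bilinearity all
  -- commutators, hence all of `G' ≅ 𝔽_p³`; so `v = 0`.
  obtain ⟨v, hv, hv0⟩ := Matrix.exists_mulVec_eq_zero_iff.2 h0
  have h12 : commutatorPairing e (a 1) (a 2) ⬝ᵥ v = 0 := congrFun hv0 0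
  have h20 : commutatorPairing e (a 2) (a 0) ⬝ᵥ v = 0 := congrFun hv0 1
  have h01 : commutatorPairing e (a 0) (a 1) ⬝ᵥ v = 0 := congrFun hv0 2
  have haa : ∀ i j, commutatorPairing e (a i) (a j) ⬝ᵥ v = 0 := by
    have h21 : commutatorPairing e (a 2) (a 1) ⬝ᵥ v = 0 := by
      rw [commutatorPairing_swap, neg_dotProduct, h12, neg_zero]
    have h02 : commutatorPairing e (a 0) (a 2) ⬝ᵥ v = 0 := by
      rw [commutatorPairing_swap, neg_dotProduct, h20, neg_zero]
    have h10 : commutatorPairing e (a 1) (a 0) ⬝ᵥ v = 0 := by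
      rw [commutatorPairing_swap, neg_dotProduct, h01, neg_zero]
    intro i j
    fin_cases i <;> fin_cases j <;>
      first | assumption | exact (by rw [commutatorPairing_self, zero_dotProduct])
  have hgg : ∀ g h, commutatorPairing e g h ⬝ᵥ v = 0 := by
    intro g h
    obtain ⟨r, hr⟩ := ha g
    obtain ⟨s, hs⟩ := ha h
    rw [commutatorPairing_of_eq_prod e hc hr, sum_dotProduct]
    refine Finset.sum_eq_zero fun i _ => ?_
    rw [smul_dotProduct, commutatorPairing_of_eq_prod_right e hc hs, sum_dotProduct,
      Finset.sum_eq_zero, smul_zero]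
    intro j _
    rw [smul_dotProduct, haa, smul_zero]
  have hall : ∀ g (hg : g ∈ commutator G), (e ⟨g, hg⟩).toAdd ⬝ᵥ v = 0 := by
    let φ : commutator G →* Multiplicative (ZMod p) :=
      { toFun := fun x => .ofAdd ((e x).toAdd ⬝ᵥ v)
        map_one' := by simp
        map_mul' := fun x y => by rw [map_mul, toAdd_mul, add_dotProduct, ofAdd_add] }
    have hle : commutator G ≤ φ.ker.map (commutator G).subtype := by
      conv_lhs => rw [commutator_eq_closure]
      rw [Subgroup.closure_le]
      rintro _ ⟨g, h, rfl⟩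
      exact ⟨⟨_, Subgroup.commutator_mem_commutator (Subgroup.mem_top g) (Subgroup.mem_top h)⟩,
        congrArg Multiplicative.ofAdd (hgg g h), rfl⟩
    intro g hg
    obtain ⟨x, hx, rfl⟩ := hle hg
    exact congrArg Multiplicative.toAdd hx
  refine hv (funext fun i => ?_)
  have := hall _ (e.symm (.ofAdd (Pi.single i 1))).2
  simpa using this

/-- The pairing is bilinear and alternating, so the coefficients of `[b i, b k]` are the cross
product of rows `i` and `k` of `r`; these are its cofactors. -/
theorem commutatorMatrix_change (hc : commutator G ≤ Subgroup.center G) {a b : Fin 3 → G}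
    {r : Matrix (Fin 3) (Fin 3) ℤ}
    (hb : ∀ i, Abelianization.of (b i) = ∏ j, Abelianization.of (a j) ^ r i j) :
    commutatorMatrix e b =
      (r.map (Int.cast : ℤ → ZMod p)).adjugate.transpose * commutatorMatrix e a := by
  have hbb : ∀ i k, commutatorPairing e (b i) (b k) =
      (r i 1 * r k 2 - r i 2 * r k 1) • commutatorPairing e (a 1) (a 2) +
      (r i 2 * r k 0 - r i 0 * r k 2) • commutatorPairing e (a 2) (a 0) +
      (r i 0 * r k 1 - r i 1 * r k 0) • commutatorPairing e (a 0) (a 1) := by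
    intro i k
    rw [commutatorPairing_of_eq_prod e hc (hb i), Fin.sum_univ_three,
      commutatorPairing_of_eq_prod_right e hc (hb k),
      commutatorPairing_of_eq_prod_right e hc (hb k),
      commutatorPairing_of_eq_prod_right e hc (hb k), Fin.sum_univ_three, Fin.sum_univ_three,
      Fin.sum_univ_three, commutatorPairing_self, commutatorPairing_self, commutatorPairing_self,
      commutatorPairing_swap e (a 1) (a 0), commutatorPairing_swap e (a 2) (a 1),
      commutatorPairing_swap e (a 0) (a 2)]
    module
  ext i j
  fin_cases i <;>
    simp [commutatorMatrix, hbb, Matrix.mul_apply, Fin.sum_univ_three, Matrix.adjugate_fin_three,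
      -zsmul_eq_mul] <;> ring

/-- Without commutator corrections, `b i ^ p ^ m i = ∏ a j ^ (r i j * p ^ m i) = ∏ (a j ^ p ^ m j) ^
s i j`. -/
theorem powerMatrix_change (hc : commutator G ≤ Subgroup.center G) (h₁₂ : m 0 > m 1)
    (h₂₃ : m 1 > m 2) (h₃ : 0 < m 2) {a b : Fin 3 → G}
    (ha : ∀ i, a i ^ p ^ m i ∈ commutator G) (hb : ∀ i, b i ^ p ^ m i ∈ commutator G)
    {r s : Matrix (Fin 3) (Fin 3) ℤ}
    (hr : ∀ i, Abelianization.of (b i) = ∏ j, Abelianization.of (a j) ^ r i j)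
    (hs : ∀ i j, r i j * (p ^ m i : ℕ) = (p ^ m j : ℕ) * s i j) :
    powerMatrix e m hb = s.map (Int.cast : ℤ → ZMod p) * powerMatrix e m ha := by
  have hp : p.Prime := Fact.out
  have hpos : ∀ i, 0 < m i := by
    intro i; fin_cases i
    · exact (h₃.trans h₂₃).trans h₁₂
    · exact h₃.trans h₂₃
    · exact h₃
  have key : ∀ i, b i ^ p ^ m i = (a 0 ^ p ^ m 0) ^ s i 0 * ((a 1 ^ p ^ m 1) ^ s i 1 *
      (a 2 ^ p ^ m 2) ^ s i 2) := by
    intro i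
    -- The binomial coefficient can fail to be divisible by `p` only for `p = 2` and `m i = 1`, thus
    -- only for `i = 2`; there the exponents of `a 0` and `a 1` are divisible by `p` because their
    -- orders are larger.
    have hor : p ∣ (p ^ m i).choose 2 ∨ (p : ℤ) ∣ r i 0 ∧ (p : ℤ) ∣ r i 1 := by
      by_cases hi : i = 2
      · right
        subst hi
        have aux : ∀ j, m j > m 2 → (p : ℤ) ∣ r 2 j := by
          intro j hj
          have h := hs 2 j
          obtain ⟨k, hk⟩ : ∃ k, m j = m 2 + 1 + k := ⟨m j - m 2 - 1, by omega⟩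
          have hne : ((p ^ m 2 : ℕ) : ℤ) ≠ 0 := by exact_mod_cast pow_ne_zero _ hp.ne_zero
          refine ⟨(p : ℤ) ^ k * s 2 j, mul_right_cancel₀ hne ?_⟩
          rw [h, hk]
          push_cast
          ring
        exact ⟨aux 0 (h₂₃.trans h₁₂), aux 1 h₂₃⟩
      · left
        have hm2 : 2 ≤ m i := by
          fin_cases i
          · simp; omega
          · simp; omega
          · exact absurd rfl hi
        have h2 : (p ^ m i).choose 2 * 2 = p ^ m i * (p ^ m i - 1) := by
          rw [Nat.choose_two_right]
          exact Nat.div_mul_cancel (Nat.even_mul_pred_self _).two_dvd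
        have hd : p * p ∣ (p ^ m i).choose 2 * 2 := by
          rw [h2, ← sq]
          exact (pow_dvd_pow p hm2).mul_right _
        by_cases hp2 : p = 2
        · subst hp2
          exact Nat.dvd_of_mul_dvd_mul_right (by norm_num) hd
        · exact Nat.Coprime.dvd_of_dvd_mul_right ((Nat.coprime_primes hp Nat.prime_two).2 hp2)
            ((dvd_mul_right p p).trans hd)
    rw [pow_eq_mul_mul_of_abelianization e hc nsmul_prime_eq_zero
      (dvd_pow_self p (hpos i).ne') (hr i) hor, hs, hs, hs]
    simp only [zpow_mul, zpow_natCast]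
  ext i k
  have : (⟨_, hb i⟩ : commutator G) = ⟨_, ha 0⟩ ^ s i 0 * (⟨_, ha 1⟩ ^ s i 1 *
      ⟨_, ha 2⟩ ^ s i 2) := Subtype.ext (key i)
  have h2 := congrArg (fun x => (e x).toAdd k) this
  simp only [map_mul, map_zpow, toAdd_mul, toAdd_zpow] at h2
  rw [Matrix.mul_apply, Fin.sum_univ_three]
  change (e ⟨_, hb i⟩).toAdd k = _
  rw [h2]
  simp [powerMatrix, add_assoc]

end CharacteristicMatrix

/-! ### Bases of finite abelian groups. -/

section InternalProduct

variable {A : Type*} [CommGroup A]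

theorem zpow_sum_eq {ι : Type*} (a : A) (s : Finset ι) (f : ι → ℤ) :
    ∏ i ∈ s, a ^ f i = a ^ ∑ i ∈ s, f i :=
  ((map_sum (zmultiplesHom (Additive A) (.ofMul a)) f s)).symm

theorem prod_zpow_prod_zpow {ι : Type*} [Fintype ι] {α β : ι → A} {r : Matrix ι ι ℤ}
    (h : ∀ i, β i = ∏ j, α j ^ r i j) (t : ι → ℤ) :
    ∏ i, β i ^ t i = ∏ j, α j ^ Matrix.vecMul t r j := by
  simp_rw [h, ← Finset.prod_zpow, ← zpow_mul]
  rw [Finset.prod_comm]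
  refine Finset.prod_congr rfl fun j _ => ?_
  rw [Matrix.vecMul, dotProduct, ← zpow_sum_eq]
  simp_rw [mul_comm]

theorem exists_eq_prod_zpow {ι : Type*} [Fintype ι] {α : ι → A}
    (h : Function.Surjective
      (fun k : (i : ι) → Subgroup.zpowers (α i) => ∏ i, (k i : A))) (x : A) :
    ∃ r : ι → ℤ, x = ∏ i, α i ^ r i := by
  obtain ⟨k, rfl⟩ := h x
  choose r hr using fun i => Subgroup.mem_zpowers_iff.1 (k i).2
  exact ⟨r, by simp_rw [hr]⟩

theorem orderOf_dvd_of_prod_zpow_eq_one {ι : Type*} [Fintype ι] {α : ι → A}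
    (h : Function.Injective
      (fun k : (i : ι) → Subgroup.zpowers (α i) => ∏ i, (k i : A))) {r : ι → ℤ}
    (hr : ∏ i, α i ^ r i = 1) (i : ι) : (orderOf (α i) : ℤ) ∣ r i := by
  have : (fun i => (⟨α i ^ r i, Subgroup.zpow_mem_zpowers _ _⟩ : Subgroup.zpowers (α i))) =
      fun i => 1 := h (by simpa using hr)
  rw [orderOf_dvd_iff_zpow_eq_one]
  exact congrArg Subtype.val (congrFun this i)

/-- Counting: generation makes the product map onto `A` surjective, while its source has `∏ orderOf
(α i) ≤ ∏ n i = |A|` elements, so equality holds throughout. -/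
theorem orderOf_eq_and_bijective {ι : Type*} [Fintype ι] [Finite A] {α : ι → A} {n : ι → ℕ}
    (hn : ∀ i, 0 < n i) (hcard : Nat.card A = ∏ i, n i) (hpow : ∀ i, α i ^ n i = 1)
    (hgen : ∀ x, ∃ r : ι → ℤ, x = ∏ i, α i ^ r i) :
    (∀ i, orderOf (α i) = n i) ∧ Function.Bijective
      (fun k : (i : ι) → Subgroup.zpowers (α i) => ∏ i, (k i : A)) := by
  have hle : ∀ i, orderOf (α i) ≤ n i := fun i =>
    Nat.le_of_dvd (hn i) (orderOf_dvd_of_pow_eq_one (hpow i))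
  have hsurj : Function.Surjective
      (fun k : (i : ι) → Subgroup.zpowers (α i) => ∏ i, (k i : A)) := fun x => by
    obtain ⟨r, rfl⟩ := hgen x
    exact ⟨fun i => ⟨α i ^ r i, Subgroup.zpow_mem_zpowers _ _⟩, rfl⟩
  have hdom : Nat.card ((i : ι) → Subgroup.zpowers (α i)) = ∏ i, orderOf (α i) := by
    rw [Nat.card_pi]
    simp_rw [Nat.card_zpowers]
  have hprod : ∏ i, orderOf (α i) ≤ ∏ i, n i := Finset.prod_le_prod' fun i _ => hle i
  refine ⟨fun i => ?_, hsurj.bijective_of_nat_card_le (by rw [hdom, hcard]; exact hprod)⟩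
  by_contra hne
  have hlt : ∏ i, orderOf (α i) < ∏ i, n i :=
    Finset.prod_lt_prod (fun i _ => orderOf_pos _) (fun i _ => hle i)
      ⟨i, Finset.mem_univ i, lt_of_le_of_ne (hle i) hne⟩
  have := Nat.card_le_card_of_surjective _ hsurj
  rw [hdom, hcard] at this
  exact this.not_gt hlt

/-- An integral matrix whose determinant is prime to the order of the group sends generators to
generators. -/
theorem exists_eq_prod_zpow_of_isCoprime_det {ι : Type*} [Fintype ι] [DecidableEq ι]
    {α β : ι → A} {r : Matrix ι ι ℤ} (h : ∀ i, β i = ∏ j, α j ^ r i j)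
    (hgen : ∀ x, ∃ c : ι → ℤ, x = ∏ i, α i ^ c i)
    (hdet : IsCoprime r.det (Nat.card A)) (x : A) : ∃ t : ι → ℤ, x = ∏ i, β i ^ t i := by
  obtain ⟨u, v, huv⟩ := hdet
  obtain ⟨c, hc⟩ := hgen (x ^ u)
  -- As `adjugate r * r = det r • 1`, these exponents give `x ^ (u * det r)`, which is `x` by the
  -- Bézout relation modulo `|A|`.
  refine ⟨Matrix.vecMul c r.adjugate, ?_⟩
  rw [prod_zpow_prod_zpow h, Matrix.vecMul_vecMul, Matrix.adjugate_mul, Matrix.vecMul_smul,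
    Matrix.vecMul_one]
  simp_rw [Pi.smul_apply, smul_eq_mul, mul_comm r.det, zpow_mul]
  rw [Finset.prod_zpow, ← hc, ← zpow_mul, eq_sub_of_add_eq huv, zpow_sub, zpow_one, zpow_mul,
    zpow_natCast, pow_card_eq_one', inv_one, mul_one]

end InternalProduct

/-! ### Change of generators corresponds to equivalence of matrices. -/

section ChangeOfGenerators

variable {p : ℕ} {m : Fin 3 → ℕ} {G : Type*} [Group G]

theorem IsCharacteristicGenerators.pow_mem {w : Matrix (Fin 3) (Fin 3) (ZMod p)} {a : Fin 3 → G}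
    (ha : IsCharacteristicGenerators p m w a) (i : Fin 3) : a i ^ p ^ m i ∈ commutator G := by
  rw [← Abelianization.ker_of, MonoidHom.mem_ker, map_pow, ← ha.orderOf_eq i, pow_orderOf_eq_one]

variable [Fact p.Prime]

theorem prime_dvd_of_mul_pow_eq {x y : ℤ} {k l : ℕ} (h : x * (p ^ k : ℕ) = (p ^ l : ℕ) * y)
    (hkl : k < l) : (p : ℤ) ∣ x := by
  have hp : p.Prime := Fact.out
  obtain ⟨n, rfl⟩ : ∃ n, l = k + 1 + n := ⟨l - k - 1, by omega⟩
  have hne : ((p ^ k : ℕ) : ℤ) ≠ 0 := by exact_mod_cast pow_ne_zero _ hp.ne_zero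
  refine ⟨(p : ℤ) ^ n * y, mul_right_cancel₀ hne ?_⟩
  rw [h]
  push_cast
  ring

theorem strictAnti_fin_three (h₁₂ : m 0 > m 1) (h₂₃ : m 1 > m 2) {i j : Fin 3} (h : i < j) :
    m j < m i := by
  fin_cases i <;> fin_cases j <;> simp at h ⊢ <;> omega

/-- Two characteristic matrices of the same group are equivalent. -/
theorem IsCharacteristicGenerators.related (h₁₂ : m 0 > m 1) (h₂₃ : m 1 > m 2) (h₃ : 0 < m 2)
    (hc : commutator G ≤ Subgroup.center G)
    (e : commutator G ≃* Multiplicative (Fin 3 → ZMod p))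
    {w w' : Matrix (Fin 3) (Fin 3) (ZMod p)} {a b : Fin 3 → G}
    (ha : IsCharacteristicGenerators p m w a) (hb : IsCharacteristicGenerators p m w' b) :
    Related w w' := by
  have hp : p.Prime := Fact.out
  have hgen := fun g : G =>
    exists_eq_prod_zpow ha.directProduct.surjective (Abelianization.of g)
  have hgen' := fun g : G =>
    exists_eq_prod_zpow hb.directProduct.surjective (Abelianization.of g)
  choose r hr using fun i => hgen (b i)
  -- The image of `b i` is killed by `p ^ m i`, and in a direct product this holds in each
  -- component.
  have hdvd : ∀ i j, ((p ^ m j : ℕ) : ℤ) ∣ r i j * (p ^ m i : ℕ) := by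
    intro i j
    rw [← ha.orderOf_eq j]
    refine orderOf_dvd_of_prod_zpow_eq_one (r := fun j => r i j * (p ^ m i : ℕ))
      ha.directProduct.injective ?_ j
    simp_rw [zpow_mul]
    rw [Finset.prod_zpow, ← hr, ← hb.orderOf_eq i, zpow_natCast, pow_orderOf_eq_one]
  choose s hs using hdvd
  let R : Matrix (Fin 3) (Fin 3) (ZMod p) := (Matrix.of r).map (Int.cast : ℤ → ZMod p)
  let S : Matrix (Fin 3) (Fin 3) (ZMod p) := (Matrix.of s).map (Int.cast : ℤ → ZMod p)
  have hX : commutatorMatrix e b = R.adjugate.transpose * commutatorMatrix e a :=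
    commutatorMatrix_change e hc (r := Matrix.of r) hr
  have hV : powerMatrix e m hb.pow_mem = S * powerMatrix e m ha.pow_mem :=
    powerMatrix_change e hc h₁₂ h₂₃ h₃ ha.pow_mem hb.pow_mem (r := Matrix.of r)
      (s := Matrix.of s) hr hs
  have hua := isUnit_det_commutatorMatrix e hc hgen
  have hub := isUnit_det_commutatorMatrix e hc hgen'
  have hR : ∀ i j, j < i → R i j = 0 := fun i j hij =>
    (ZMod.intCast_zmod_eq_zero_iff_dvd _ _).2
      (prime_dvd_of_mul_pow_eq (hs i j) (strictAnti_fin_three h₁₂ h₂₃ hij))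
  have hS : ∀ i j, i < j → S i j = 0 := fun i j hij =>
    (ZMod.intCast_zmod_eq_zero_iff_dvd _ _).2
      (prime_dvd_of_mul_pow_eq (x := s i j) (y := r i j) (by rw [mul_comm, ← hs, mul_comm])
        (strictAnti_fin_three h₁₂ h₂₃ hij))
  have hRS : ∀ i, S i i = R i i := fun i => by
    have hne : ((p ^ m i : ℕ) : ℤ) ≠ 0 := by exact_mod_cast pow_ne_zero _ hp.ne_zero
    have : r i i = s i i := mul_right_cancel₀ hne (by rw [hs, mul_comm])
    exact congrArg Int.cast this.symm
  -- The cofactor matrix of `R` carries one invertible commutator matrix to another.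
  have hdet : R.det ≠ 0 := by
    intro h0
    rw [hX, Matrix.det_mul, Matrix.det_transpose, Matrix.det_adjugate, h0] at hub
    simp at hub
  have hdiag : ∀ i, R i i ≠ 0 := by
    have : R.transpose.det = ∏ i, R.transpose i i :=
      Matrix.det_of_isLowerTriangular _ fun i j h => hR j i h
    rw [Matrix.det_transpose] at this
    rw [this, Finset.prod_ne_zero_iff] at hdet
    exact fun i => hdet i (Finset.mem_univ i)
  have hwa := (pow_eq_iff_powerMatrix_eq e ha.pow_mem w).1 ha.pow_eq
  have hwb := (pow_eq_iff_powerMatrix_eq e hb.pow_mem w').1 hb.pow_eq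
  have hmain : w' * R.adjugate.transpose = S * w := by
    have h1 : w' * R.adjugate.transpose * commutatorMatrix e a = S * w * commutatorMatrix e a := by
      rw [Matrix.mul_assoc, ← hX, ← hwb, hV, hwa, Matrix.mul_assoc]
    have h2 := congrArg (· * (commutatorMatrix e a)⁻¹) h1
    simpa only [Matrix.mul_assoc, Matrix.mul_nonsing_inv _ hua, Matrix.mul_one] using h2
  -- Multiplying `hmain` on the right by `Rᵀ` turns the cofactor matrix into the scalar `det R`.
  refine ⟨S, R.transpose, ⟨hS, fun i => by rw [hRS]; exact hdiag i⟩, ⟨fun i j h => hR j i h, hdiag⟩,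
    hRS, ?_⟩
  rw [← hmain, Matrix.mul_assoc, ← Matrix.transpose_mul, Matrix.mul_adjugate, Matrix.det_transpose]
  simp

/-- Equivalent matrices are characteristic matrices of the same groups. -/
theorem IsCharacteristicGenerators.exists_of_related [Finite G] (h₁₂ : m 0 > m 1)
    (h₂₃ : m 1 > m 2) (h₃ : 0 < m 2) (hc : commutator G ≤ Subgroup.center G)
    (e : commutator G ≃* Multiplicative (Fin 3 → ZMod p))
    (hcard : Nat.card (Abelianization G) = ∏ i, p ^ m i)
    {w w' : Matrix (Fin 3) (Fin 3) (ZMod p)} {a : Fin 3 → G}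
    (ha : IsCharacteristicGenerators p m w a) (h : Related w w') :
    ∃ b : Fin 3 → G, IsCharacteristicGenerators p m w' b := by
  have hp : p.Prime := Fact.out
  obtain ⟨S, L, hS, hL, hSL, hw⟩ := h
  -- Integral lifts: `r` reduces to `Lᵀ` and `s` to `S`. The triangle that vanishes modulo `p` in
  -- one matrix is filled with the power of `p` times the lift used in the other, so that `r i j * p
  -- ^ m i = p ^ m j * s i j`; on the diagonal this needs `S i i = L i i`.
  let r : Matrix (Fin 3) (Fin 3) ℤ := Matrix.of fun i j =>
    if i ≤ j then (L j i).val else p ^ (m j - m i) * (S i j).val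
  let s : Matrix (Fin 3) (Fin 3) ℤ := Matrix.of fun i j =>
    if i < j then p ^ (m i - m j) * (L j i).val else (S i j).val
  have hrs : ∀ i j, r i j * (p ^ m i : ℕ) = (p ^ m j : ℕ) * s i j := by
    intro i j
    rcases lt_trichotomy i j with h | rfl | h
    · have := strictAnti_fin_three h₁₂ h₂₃ h
      obtain ⟨k, hk⟩ := Nat.exists_eq_add_of_le this.le
      simp [r, s, h, h.le, hk]; ring
    · simp [r, s, hSL]; ring
    · have := strictAnti_fin_three h₁₂ h₂₃ h
      obtain ⟨k, hk⟩ := Nat.exists_eq_add_of_le this.le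
      simp [r, s, h.not_ge, h.not_gt, hk]; ring
  have hrL : r.map (Int.cast : ℤ → ZMod p) = L.transpose := by
    ext i j
    by_cases h : i ≤ j
    · simp [r, h]
    · have := strictAnti_fin_three h₁₂ h₂₃ (not_le.1 h)
      simp [r, h, hL.eq_zero j i (not_le.1 h), (Nat.sub_pos_of_lt this).ne']
  have hsS : s.map (Int.cast : ℤ → ZMod p) = S := by
    ext i j
    by_cases h : i < j
    · have := strictAnti_fin_three h₁₂ h₂₃ h
      simp [s, h, hS.eq_zero i j h, (Nat.sub_pos_of_lt this).ne']
    · simp [s, h]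
  let b : Fin 3 → G := fun i => a 0 ^ r i 0 * a 1 ^ r i 1 * a 2 ^ r i 2
  have hb : ∀ i, Abelianization.of (b i) = ∏ j, Abelianization.of (a j) ^ r i j := fun i => by
    simp [b, Fin.prod_univ_three]
  have hdet : IsCoprime r.det (Nat.card (Abelianization G)) := by
    have hcop : IsCoprime r.det (p : ℤ) := by
      rw [isCoprime_comm, Prime.coprime_iff_not_dvd (Nat.prime_iff_prime_int.1 hp),
        ← ZMod.intCast_zmod_eq_zero_iff_dvd]
      have : ((r.det : ℤ) : ZMod p) = (r.map (Int.cast : ℤ → ZMod p)).det :=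
        (Int.castRingHom (ZMod p)).map_det r
      rw [this, hrL, Matrix.det_transpose]
      exact hL.isUnit_det.ne_zero
    rw [hcard, Finset.prod_pow_eq_pow_sum, Nat.cast_pow]
    exact hcop.pow_right
  have hgen := exists_eq_prod_zpow_of_isCoprime_det hb
    (exists_eq_prod_zpow ha.directProduct.surjective) hdet
  have hbpow : ∀ i, Abelianization.of (b i) ^ p ^ m i = 1 := by
    intro i
    rw [hb, ← Finset.prod_pow]
    refine Finset.prod_eq_one fun j _ => ?_
    rw [← zpow_natCast, ← zpow_mul, hrs, zpow_mul, zpow_natCast, ← ha.orderOf_eq j,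
      pow_orderOf_eq_one, one_zpow]
  have hbm : ∀ i, b i ^ p ^ m i ∈ commutator G := fun i => by
    rw [← Abelianization.ker_of, MonoidHom.mem_ker, map_pow, hbpow]
  obtain ⟨ho, hbij⟩ := orderOf_eq_and_bijective (fun i => pow_pos hp.pos (m i)) hcard hbpow hgen
  refine ⟨b, ho, hbij, (pow_eq_iff_powerMatrix_eq e hbm w').2 ?_⟩
  have hwa := (pow_eq_iff_powerMatrix_eq e ha.pow_mem w).1 ha.pow_eq
  rw [powerMatrix_change e hc h₁₂ h₂₃ h₃ ha.pow_mem hbm hb hrs, commutatorMatrix_change e hc hb,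
    hrL, hsS, hwa, ← Matrix.adjugate_transpose, Matrix.transpose_transpose, ← Matrix.mul_assoc,
    ← Matrix.mul_assoc]
  congr 1
  have hd := hL.isUnit_det.ne_zero
  have := congrArg (· * L.adjugate) hw
  simp only [Matrix.mul_assoc, Matrix.mul_adjugate, Matrix.smul_mul, Matrix.mul_smul,
    Matrix.mul_one] at this
  exact (smul_right_injective _ hd this).symm

end ChangeOfGenerators

/-! ### Existence and uniqueness of the listed characteristic matrix. -/

section ThreeGenGroup

variable {p : ℕ} {m : Fin 3 → ℕ} {G : Type*} [Group G] [Finite G]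

theorem IsThreeGenGroup.card_abelianization (h : IsThreeGenGroup p m G) :
    Nat.card (Abelianization G) = ∏ i, p ^ m i := by
  obtain ⟨φ⟩ := h.abelianization
  rw [Nat.card_congr φ.toEquiv, Nat.card_pi]
  exact Finset.prod_congr rfl fun i _ => Nat.card_zmod _

variable [Fact p.Prime]

/-- Any lifts of the standard basis of `G / G'` serve, since their commutator matrix is invertible.
-/
theorem IsThreeGenGroup.exists_isCharacteristicMatrix (h : IsThreeGenGroup p m G) :
    ∃ w, IsCharacteristicMatrix p m G w := by
  have hp : p.Prime := Fact.out
  obtain ⟨φ⟩ := h.abelianization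
  obtain ⟨e⟩ := h.derived
  have hc := h.commutator_le_center
  choose a ha using fun i : Fin 3 =>
    QuotientGroup.mk_surjective (φ.symm (Pi.mulSingle i (.ofAdd (1 : ZMod (p ^ m i)))))
  replace ha : ∀ i, Abelianization.of (a i) =
    φ.symm (Pi.mulSingle i (.ofAdd (1 : ZMod (p ^ m i)))) := ha
  have hpow : ∀ i, Abelianization.of (a i) ^ p ^ m i = 1 := fun i => by
    rw [ha, ← map_pow, ← Pi.mulSingle_pow, ← ofAdd_nsmul]
    simp
  have hgen : ∀ x, ∃ r : Fin 3 → ℤ, x = ∏ i, Abelianization.of (a i) ^ r i := fun x => by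
    refine ⟨fun i => ((φ x i).toAdd.val : ℤ), φ.injective ?_⟩
    rw [map_prod]
    simp_rw [map_zpow, ha, MulEquiv.apply_symm_apply]
    rw [← Finset.univ_prod_mulSingle (φ x)]
    refine Finset.prod_congr rfl fun i _ => ?_
    have : NeZero (p ^ m i) := ⟨pow_ne_zero _ hp.ne_zero⟩
    rw [Finset.univ_prod_mulSingle, zpow_natCast, ← Pi.mulSingle_pow, ← ofAdd_nsmul]
    simp
  obtain ⟨ho, hbij⟩ :=
    orderOf_eq_and_bijective (fun i => pow_pos hp.pos (m i)) h.card_abelianization hpow hgen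
  have ham : ∀ i, a i ^ p ^ m i ∈ commutator G := fun i => by
    rw [← Abelianization.ker_of, MonoidHom.mem_ker, map_pow, hpow]
  have hu := isUnit_det_commutatorMatrix e hc fun g => hgen (Abelianization.of g)
  refine ⟨powerMatrix e m ham * (commutatorMatrix e a)⁻¹, a, ho, hbij,
    (pow_eq_iff_powerMatrix_eq e ham _).2 ?_⟩
  rw [Matrix.mul_assoc, Matrix.nonsing_inv_mul _ hu, Matrix.mul_one]

theorem IsThreeGenGroup.exists_isListed {η : ZMod p} (hη : p ≠ 2 → ¬ IsSquare η)
    (h₁₂ : m 0 > m 1) (h₂₃ : m 1 > m 2) (h₃ : 0 < m 2) (h : IsThreeGenGroup p m G) :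
    ∃ w, IsListed p η w ∧ IsCharacteristicMatrix p m G w := by
  obtain ⟨w, a, ha⟩ := h.exists_isCharacteristicMatrix
  obtain ⟨w', hw', hr⟩ := exists_isListed_related hη w
  obtain ⟨e⟩ := h.derived
  exact ⟨w', hw', ha.exists_of_related h₁₂ h₂₃ h₃ h.commutator_le_center e
    h.card_abelianization hr⟩

theorem IsCharacteristicMatrix.of_mulEquiv {H : Type*} [Group H]
    {w : Matrix (Fin 3) (Fin 3) (ZMod p)} (hG : IsThreeGenGroup p m G) (f : H ≃* G)
    (h : IsCharacteristicMatrix p m H w) : IsCharacteristicMatrix p m G w := by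
  have hp : p.Prime := Fact.out
  obtain ⟨a, ho, hbij, hpow⟩ := h
  have hof : ∀ i, Abelianization.of (f (a i)) = f.abelianizationCongr (Abelianization.of (a i)) :=
    fun i => (abelianizationCongr_of f (a i)).symm
  have hpow' : ∀ i, Abelianization.of (f (a i)) ^ p ^ m i = 1 := fun i => by
    rw [hof, ← map_pow, ← ho i, pow_orderOf_eq_one, map_one]
  have hgen : ∀ x, ∃ r : Fin 3 → ℤ, x = ∏ i, Abelianization.of (f (a i)) ^ r i := fun x => by
    obtain ⟨r, hr⟩ := exists_eq_prod_zpow hbij.surjective (f.abelianizationCongr.symm x)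
    refine ⟨r, ?_⟩
    rw [MulEquiv.symm_apply_eq] at hr
    rw [hr, map_prod]
    simp_rw [map_zpow, hof]
  obtain ⟨ho', hbij'⟩ :=
    orderOf_eq_and_bijective (fun i => pow_pos hp.pos (m i)) hG.card_abelianization hpow' hgen
  refine ⟨fun i => f (a i), ho', hbij', fun i => ?_⟩
  rw [← map_pow, hpow]
  simp only [map_mul, map_pow, map_commutatorElement]

theorem IsListed.isEmpty_mulEquiv {η : ZMod p} (hη : p ≠ 2 → ¬ IsSquare η)
    (h₁₂ : m 0 > m 1) (h₂₃ : m 1 > m 2) (h₃ : 0 < m 2) {w w' : Matrix (Fin 3) (Fin 3) (ZMod p)}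
    (hw : IsListed p η w) (hw' : IsListed p η w') (hne : w ≠ w') {H : Type*} [Group H]
    (hG : IsThreeGenGroup p m G) (hGw : IsCharacteristicMatrix p m G w)
    (hHw : IsCharacteristicMatrix p m H w') : IsEmpty (G ≃* H) := by
  refine ⟨fun f => hne ?_⟩
  obtain ⟨a, ha⟩ := hGw
  obtain ⟨b, hb⟩ := hHw.of_mulEquiv hG f.symm
  obtain ⟨e⟩ := hG.derived
  exact (hw.eq_of_related hη hw' (ha.related h₁₂ h₂₃ h₃ hG.commutator_le_center e hb)).symm

end ThreeGenGroup

/-! ### Construction of a group with a prescribed characteristic matrix. -/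

/-- The underlying set of the central extension of `ℤ³` by `𝔽_p³` whose commutator pairing is the
cross product. -/
@[ext]
structure CrossExtension (p : ℕ) where
  /-- The coordinates in `ℤ³`. -/
  base : Fin 3 → ℤ
  /-- The coordinates in the central subgroup. -/
  fiber : Fin 3 → ZMod p

namespace CrossExtension

section Group

variable {p : ℕ}

/-- The cocycle of the extension. -/
def cocycle (p : ℕ) (x y : Fin 3 → ℤ) : Fin 3 → ZMod p :=
  ![(x 1 * y 2 : ℤ), (x 2 * y 0 : ℤ), (x 0 * y 1 : ℤ)]

theorem cocycle_add_left (x x' y : Fin 3 → ℤ) :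
    cocycle p (x + x') y = cocycle p x y + cocycle p x' y := by
  ext i; fin_cases i <;> simp [cocycle, add_mul]

theorem cocycle_add_right (x y y' : Fin 3 → ℤ) :
    cocycle p x (y + y') = cocycle p x y + cocycle p x y' := by
  ext i; fin_cases i <;> simp [cocycle, mul_add]

@[simp]
theorem cocycle_zero_left (y : Fin 3 → ℤ) : cocycle p 0 y = 0 := by
  ext i; fin_cases i <;> simp [cocycle]

@[simp]
theorem cocycle_zero_right (x : Fin 3 → ℤ) : cocycle p x 0 = 0 := by
  ext i; fin_cases i <;> simp [cocycle]

theorem cocycle_neg_left (x y : Fin 3 → ℤ) : cocycle p (-x) y = - cocycle p x y := by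
  ext i; fin_cases i <;> simp [cocycle]

theorem cocycle_eq_zero_left {x : Fin 3 → ℤ} (hx : ∀ i, ((x i : ℤ) : ZMod p) = 0)
    (y : Fin 3 → ℤ) : cocycle p x y = 0 := by
  ext i; fin_cases i <;> simp [cocycle, hx]

theorem cocycle_eq_zero_right (x : Fin 3 → ℤ) {y : Fin 3 → ℤ}
    (hy : ∀ i, ((y i : ℤ) : ZMod p) = 0) : cocycle p x y = 0 := by
  ext i; fin_cases i <;> simp [cocycle, hy]

theorem cocycle_single_self (i : Fin 3) (k l : ℤ) :
    cocycle p (Pi.single i k) (Pi.single i l) = 0 := by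
  ext j; fin_cases i <;> fin_cases j <;> simp [cocycle]

instance : Mul (CrossExtension p) :=
  ⟨fun g h => ⟨g.base + h.base, g.fiber + h.fiber + cocycle p g.base h.base⟩⟩

instance : One (CrossExtension p) := ⟨⟨0, 0⟩⟩

instance : Inv (CrossExtension p) :=
  ⟨fun g => ⟨-g.base, -g.fiber + cocycle p g.base g.base⟩⟩

@[simp] theorem base_mul (g h : CrossExtension p) : (g * h).base = g.base + h.base := rfl
@[simp] theorem fiber_mul (g h : CrossExtension p) :
    (g * h).fiber = g.fiber + h.fiber + cocycle p g.base h.base := rfl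
@[simp] theorem base_one : (1 : CrossExtension p).base = 0 := rfl
@[simp] theorem fiber_one : (1 : CrossExtension p).fiber = 0 := rfl
@[simp] theorem base_inv (g : CrossExtension p) : (g⁻¹).base = -g.base := rfl
@[simp] theorem fiber_inv (g : CrossExtension p) :
    (g⁻¹).fiber = -g.fiber + cocycle p g.base g.base := rfl

instance : Group (CrossExtension p) :=
  Group.ofLeftAxioms
    (fun a b c => by
      ext1
      · simp [add_assoc]
      · simp [cocycle_add_left, cocycle_add_right]; abel)
    (fun a => by ext1 <;> simp)
    (fun a => by ext1 <;> simp [cocycle_neg_left])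

/-- The standard generators. -/
def gen (p : ℕ) (i : Fin 3) : CrossExtension p := ⟨Pi.single i 1, 0⟩

/-- The inclusion of the central subgroup. -/
def incl (p : ℕ) : Multiplicative (Fin 3 → ZMod p) →* CrossExtension p where
  toFun c := ⟨0, c.toAdd⟩
  map_one' := rfl
  map_mul' c d := by ext1 <;> simp

theorem gen_zpow (i : Fin 3) (k : ℤ) : gen p i ^ k = ⟨Pi.single i k, 0⟩ := by
  let f : Multiplicative ℤ →* CrossExtension p :=
    { toFun := fun k => ⟨Pi.single i k.toAdd, 0⟩
      map_one' := by ext1 <;> simp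
      map_mul' := fun k l => by ext1 <;> simp [Pi.single_add, cocycle_single_self] }
  have : f (.ofAdd 1 ^ k) = f (.ofAdd 1) ^ k := map_zpow f _ k
  rw [← ofAdd_zsmul, smul_eq_mul, mul_one] at this
  exact this.symm

theorem eq_mul_incl (g : CrossExtension p) :
    ∃ c, g = gen p 0 ^ g.base 0 * gen p 1 ^ g.base 1 * gen p 2 ^ g.base 2 * incl p c := by
  set h := gen p 0 ^ g.base 0 * gen p 1 ^ g.base 1 * gen p 2 ^ g.base 2 with hh
  have hb : h.base = g.base := by
    rw [hh]
    ext i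
    fin_cases i <;> simp [gen_zpow]
  refine ⟨.ofAdd (h⁻¹ * g).fiber, ?_⟩
  have : incl p (.ofAdd (h⁻¹ * g).fiber) = h⁻¹ * g := by
    ext1
    · simp [incl, hb]
    · rfl
  rw [this, mul_inv_cancel_left]

theorem commutator_gen_one_two : ⁅gen p 1, gen p 2⁆ = incl p (.ofAdd (Pi.single 0 1)) := by
  rw [commutatorElement_def]
  ext i <;> fin_cases i <;> simp [gen, incl, cocycle]

theorem commutator_gen_two_zero : ⁅gen p 2, gen p 0⁆ = incl p (.ofAdd (Pi.single 1 1)) := by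
  rw [commutatorElement_def]
  ext i <;> fin_cases i <;> simp [gen, incl, cocycle]

theorem commutator_gen_zero_one : ⁅gen p 0, gen p 1⁆ = incl p (.ofAdd (Pi.single 2 1)) := by
  rw [commutatorElement_def]
  ext i <;> fin_cases i <;> simp [gen, incl, cocycle]

theorem mul_comm_of_base {g : CrossExtension p} (hg : ∀ i, ((g.base i : ℤ) : ZMod p) = 0)
    (h : CrossExtension p) : h * g = g * h := by
  ext1
  · simp [add_comm]
  · simp [cocycle_eq_zero_left hg, cocycle_eq_zero_right _ hg, add_comm]

/-- Reduction modulo `p` of the base coordinates. -/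
def reduction (p : ℕ) : CrossExtension p →* Multiplicative (Fin 3 → ZMod p) where
  toFun g := .ofAdd fun i => (g.base i : ZMod p)
  map_one' := by
    apply Multiplicative.toAdd.injective
    ext i; simp
  map_mul' g h := by
    apply Multiplicative.toAdd.injective
    ext i; simp

/-- Reduction of the base coordinates modulo `p ^ m i`. -/
def powReduction (p : ℕ) (m : Fin 3 → ℕ) :
    CrossExtension p →* ((i : Fin 3) → Multiplicative (ZMod (p ^ m i))) where
  toFun g i := .ofAdd (g.base i : ZMod (p ^ m i))
  map_one' := by ext i; simp
  map_mul' g h := by ext i; simp [ofAdd_add]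

end Group

section Quotient

variable {p : ℕ} {m : Fin 3 → ℕ} (hm : ∀ i, 0 < m i) (w : Matrix (Fin 3) (Fin 3) (ZMod p))

theorem cast_pow_mul (hm : ∀ i, 0 < m i) (q : Fin 3 → ℤ) (i : Fin 3) :
    (((p : ℤ) ^ m i * q i : ℤ) : ZMod p) = 0 := by
  simp [(hm i).ne']

/-- The central subgroup of relations that prescribe the powers of the generators. -/
def relations : Subgroup (CrossExtension p) where
  -- The products of powers of `gen p i ^ p ^ m i * (incl p (.ofAdd (w i)))⁻¹`, with exponents `q
  -- i`. As `m i > 0`, the cocycle vanishes on such bases and `q` adds under multiplication.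
  carrier := {g | ∃ q : Fin 3 → ℤ, g.base = (fun i => (p : ℤ) ^ m i * q i) ∧
    g.fiber = - Matrix.vecMul (fun i => (q i : ZMod p)) w}
  one_mem' := ⟨0, by ext i; simp, by
    have : (fun i => (((0 : Fin 3 → ℤ) i : ℤ) : ZMod p)) = 0 := by ext; simp
    rw [this]; simp⟩
  mul_mem' := by
    rintro g h ⟨q, hq, hq'⟩ ⟨r, hr, hr'⟩
    refine ⟨q + r, ?_, ?_⟩
    · rw [base_mul, hq, hr]; ext i; simp [mul_add]
    · have : (fun i => (((q + r) i : ℤ) : ZMod p)) =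
          (fun i => (q i : ZMod p)) + fun i => (r i : ZMod p) := by ext; simp
      rw [fiber_mul, hq', hr', this, Matrix.add_vecMul, hq,
        cocycle_eq_zero_left (cast_pow_mul hm q)]
      abel
  inv_mem' := by
    rintro g ⟨q, hq, hq'⟩
    refine ⟨-q, ?_, ?_⟩
    · rw [base_inv, hq]; ext i; simp
    · have : (fun i => (((-q) i : ℤ) : ZMod p)) = - fun i => (q i : ZMod p) := by ext; simp
      rw [fiber_inv, hq', this, Matrix.neg_vecMul, hq, cocycle_eq_zero_left (cast_pow_mul hm q),
        add_zero]

instance relations_normal : (relations hm w).Normal := by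
  refine ⟨fun n hn g => ?_⟩
  obtain ⟨q, hq, -⟩ := id hn
  have : ∀ i, ((n.base i : ℤ) : ZMod p) = 0 := fun i => by rw [hq]; exact cast_pow_mul hm q i
  rwa [mul_comm_of_base this, mul_inv_cancel_right]

/-- The group with prescribed characteristic matrix. -/
abbrev Model : Type := CrossExtension p ⧸ relations hm w

/-- The projection onto the model. -/
abbrev proj : CrossExtension p →* Model hm w := QuotientGroup.mk' (relations hm w)

theorem proj_surjective : Function.Surjective (proj hm w) := QuotientGroup.mk'_surjective _

/-- `reduction` on the model. -/
def modelReduction : Model hm w →* Multiplicative (Fin 3 → ZMod p) :=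
  QuotientGroup.lift _ (reduction p) (by
    rintro g ⟨q, hq, -⟩
    apply Multiplicative.toAdd.injective
    ext i
    change ((g.base i : ℤ) : ZMod p) = 0
    rw [hq]
    exact cast_pow_mul hm q i)

/-- `powReduction` on the model. -/
def modelPowReduction : Model hm w →* ((i : Fin 3) → Multiplicative (ZMod (p ^ m i))) :=
  QuotientGroup.lift _ (powReduction p m) (by
    rintro g ⟨q, hq, -⟩
    ext i
    apply Multiplicative.toAdd.injective
    change ((g.base i : ℤ) : ZMod (p ^ m i)) = 0
    rw [hq, ZMod.intCast_zmod_eq_zero_iff_dvd]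
    exact_mod_cast dvd_mul_right _ _)

theorem modelReduction_surjective : Function.Surjective (modelReduction hm w) := by
  intro v
  choose x hx using fun i => ZMod.intCast_surjective (v.toAdd i)
  exact ⟨proj hm w ⟨x, 0⟩, Multiplicative.toAdd.injective (funext hx)⟩

theorem modelPowReduction_surjective : Function.Surjective (modelPowReduction hm w) := by
  intro v
  choose x hx using fun i => ZMod.intCast_surjective (v i).toAdd
  exact ⟨proj hm w ⟨x, 0⟩, funext fun i => Multiplicative.toAdd.injective (hx i)⟩

/-- The central subgroup of the model. -/
def modelIncl : Multiplicative (Fin 3 → ZMod p) →* Model hm w := (proj hm w).comp (incl p)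

/-- No relation collapses the fiber: a relation with base `0` has `q = 0` because the base is
torsion free, so its fiber is `0` too. -/
theorem modelIncl_injective [Fact p.Prime] : Function.Injective (modelIncl hm w) := by
  rw [injective_iff_map_eq_one]
  intro c hc
  obtain ⟨q, hq, hq'⟩ := (QuotientGroup.eq_one_iff _).1 hc
  have hq0 : ∀ i, q i = 0 := fun i => by
    have : (0 : ℤ) = (p : ℤ) ^ m i * q i := congrFun hq i
    have hp : (p : ℤ) ^ m i ≠ 0 := pow_ne_zero _ (by exact_mod_cast (Fact.out : p.Prime).ne_zero)
    simpa [hp] using this.symm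
  have : (fun i => (q i : ZMod p)) = 0 := by ext i; simp [hq0]
  rw [this, Matrix.zero_vecMul, neg_zero] at hq'
  exact hq'

theorem ker_modelPowReduction : (modelPowReduction hm w).ker = (modelIncl hm w).range := by
  apply le_antisymm
  · intro g hg
    obtain ⟨g, rfl⟩ := proj_surjective hm w g
    have hd : ∀ i, ∃ q, g.base i = (p : ℤ) ^ m i * q := fun i => by
      have : ((g.base i : ℤ) : ZMod (p ^ m i)) = 0 := congrFun hg i
      rw [ZMod.intCast_zmod_eq_zero_iff_dvd] at this
      exact_mod_cast this
    choose q hq using hd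
    -- Dividing `g` by the relation with exponents `q` removes its base and adds `q * w` to its
    -- fiber.
    refine ⟨.ofAdd (g.fiber + Matrix.vecMul (fun i => (q i : ZMod p)) w), ?_⟩
    refine (QuotientGroup.eq).2 ⟨q, ?_, ?_⟩
    · simp [incl]; exact funext hq
    · simp [incl]
  · rintro _ ⟨c, rfl⟩
    ext i
    apply Multiplicative.toAdd.injective
    change ((0 : ℤ) : ZMod (p ^ m i)) = 0
    simp

/-- The generators of the model. -/
def modelGen (i : Fin 3) : Model hm w := proj hm w (gen p i)

theorem modelGen_pow (i : Fin 3) : modelGen hm w i ^ p ^ m i = modelIncl hm w (.ofAdd (w i)) := by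
  rw [modelGen, ← map_pow, ← zpow_natCast, gen_zpow, eq_comm]
  refine (QuotientGroup.eq).2 ⟨Pi.single i 1, ?_, ?_⟩
  · ext j
    by_cases h : j = i
    · subst h; simp [incl]
    · simp [incl, h]
  · have : (fun j => ((Pi.single i 1 : Fin 3 → ℤ) j : ZMod p)) = Pi.single i 1 := by
      ext j
      by_cases h : j = i
      · subst h; simp
      · simp [h]
    rw [this, Matrix.single_one_vecMul]
    simp [incl]
    rfl

theorem commutator_modelGen_one_two :
    ⁅modelGen hm w 1, modelGen hm w 2⁆ = modelIncl hm w (.ofAdd (Pi.single 0 1)) := by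
  rw [modelGen, modelGen, ← map_commutatorElement, commutator_gen_one_two]; rfl

theorem commutator_modelGen_two_zero :
    ⁅modelGen hm w 2, modelGen hm w 0⁆ = modelIncl hm w (.ofAdd (Pi.single 1 1)) := by
  rw [modelGen, modelGen, ← map_commutatorElement, commutator_gen_two_zero]; rfl

theorem commutator_modelGen_zero_one :
    ⁅modelGen hm w 0, modelGen hm w 1⁆ = modelIncl hm w (.ofAdd (Pi.single 2 1)) := by
  rw [modelGen, modelGen, ← map_commutatorElement, commutator_gen_zero_one]; rfl

theorem ofAdd_eq_mul_pow [NeZero p] (c : Fin 3 → ZMod p) : Multiplicative.ofAdd c =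
    .ofAdd (Pi.single 0 1) ^ (c 0).val * .ofAdd (Pi.single 1 1) ^ (c 1).val *
      .ofAdd (Pi.single 2 1) ^ (c 2).val := by
  apply Multiplicative.toAdd.injective
  ext i
  fin_cases i <;> simp [-nsmul_eq_mul]

theorem modelIncl_eq [NeZero p] (c : Fin 3 → ZMod p) : modelIncl hm w (.ofAdd c) =
    ⁅modelGen hm w 1, modelGen hm w 2⁆ ^ (c 0).val *
      ⁅modelGen hm w 2, modelGen hm w 0⁆ ^ (c 1).val *
      ⁅modelGen hm w 0, modelGen hm w 1⁆ ^ (c 2).val := by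
  rw [ofAdd_eq_mul_pow, commutator_modelGen_one_two, commutator_modelGen_two_zero,
    commutator_modelGen_zero_one]
  simp only [map_mul, map_pow]

theorem commutator_model [NeZero p] : commutator (Model hm w) = (modelIncl hm w).range := by
  apply le_antisymm
  · rw [← ker_modelPowReduction]
    exact Abelianization.commutator_subset_ker _
  · rintro _ ⟨c, rfl⟩
    have hcm : ∀ g h : Model hm w, ⁅g, h⁆ ∈ commutator (Model hm w) := fun g h =>
      Subgroup.commutator_mem_commutator (Subgroup.mem_top g) (Subgroup.mem_top h)
    rw [← ofAdd_toAdd c, modelIncl_eq]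
    exact mul_mem (mul_mem (pow_mem (hcm _ _) _) (pow_mem (hcm _ _) _)) (pow_mem (hcm _ _) _)

theorem card_model [Fact p.Prime] : Nat.card (Model hm w) = p ^ (∑ i, m i + 3) := by
  rw [Subgroup.card_eq_card_quotient_mul_card_subgroup (modelPowReduction hm w).ker,
    Nat.card_congr (QuotientGroup.quotientKerEquivOfSurjective _
      (modelPowReduction_surjective hm w)).toEquiv, ker_modelPowReduction,
    ← Nat.card_congr (MonoidHom.ofInjective (modelIncl_injective hm w)).toEquiv, Nat.card_pi,
    pow_add, ← Finset.prod_pow_eq_pow_sum]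
  congr 1
  · exact Finset.prod_congr rfl fun i _ => Nat.card_zmod _
  · change Nat.card (Fin 3 → ZMod p) = p ^ 3
    simp

instance finite_model [Fact p.Prime] : Finite (Model hm w) := by
  apply Nat.finite_of_card_ne_zero
  rw [card_model]
  exact pow_ne_zero _ (Fact.out : p.Prime).ne_zero

/-- Each coordinate modulo `p` maps onto a simple group, whose Frattini subgroup is trivial. So
Frattini elements have base divisible by `p`, and such elements are central. -/
theorem frattini_model_le_center [Fact p.Prime] :
    frattini (Model hm w) ≤ Subgroup.center (Model hm w) := by
  have hp : p.Prime := Fact.out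
  intro g hg
  obtain ⟨g, rfl⟩ := proj_surjective hm w g
  have hb : ∀ i, ((g.base i : ℤ) : ZMod p) = 0 := by
    intro i
    let ev : Multiplicative (Fin 3 → ZMod p) →* Multiplicative (ZMod p) :=
      AddMonoidHom.toMultiplicative (Pi.evalAddMonoidHom (fun _ : Fin 3 => ZMod p) i)
    have hev : Function.Surjective ev :=
      Function.surjective_eval (α := Fin 3) (β := fun _ => ZMod p) i
    have hle := frattini_le_comap_frattini_of_surjective
      (φ := ev.comp (modelReduction hm w)) (hev.comp (modelReduction_surjective hm w)) hg
    have hs : IsSimpleGroup (Multiplicative (ZMod p)) :=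
      CommGroup.is_simple_iff_prime_card.2 (by
        rw [show Nat.card (Multiplicative (ZMod p)) = p from Nat.card_zmod p]; exact hp)
    exact frattini_le_coatom (isCoatom_bot (α := Subgroup (Multiplicative (ZMod p)))) hle
  rw [Subgroup.mem_center_iff]
  intro h
  obtain ⟨h, rfl⟩ := proj_surjective hm w h
  rw [← map_mul, mul_comm_of_base hb, map_mul]

theorem closure_modelGen [NeZero p] :
    Subgroup.closure (Set.range (modelGen hm w)) = ⊤ := by
  rw [eq_top_iff]
  rintro g -
  obtain ⟨g, rfl⟩ := proj_surjective hm w g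
  obtain ⟨c, hc⟩ := eq_mul_incl g
  have hgen : ∀ i, modelGen hm w i ∈ Subgroup.closure (Set.range (modelGen hm w)) := fun i =>
    Subgroup.subset_closure ⟨i, rfl⟩
  have hcm : ∀ i j, ⁅modelGen hm w i, modelGen hm w j⁆ ∈
      Subgroup.closure (Set.range (modelGen hm w)) := fun i j =>
    mul_mem (mul_mem (mul_mem (hgen i) (hgen j)) (inv_mem (hgen i))) (inv_mem (hgen j))
  rw [hc, map_mul, map_mul, map_mul, map_zpow, map_zpow, map_zpow]
  refine mul_mem (mul_mem (mul_mem (zpow_mem (hgen 0) _) (zpow_mem (hgen 1) _))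
    (zpow_mem (hgen 2) _)) ?_
  change modelIncl hm w (.ofAdd c.toAdd) ∈ _
  rw [modelIncl_eq]
  exact mul_mem (mul_mem (pow_mem (hcm _ _) _) (pow_mem (hcm _ _) _)) (pow_mem (hcm _ _) _)

theorem rank_model [Fact p.Prime] : Group.rank (Model hm w) = 3 := by
  classical
  apply le_antisymm
  · have h := Group.rank_le (G := Model hm w)
      (S := Finset.univ.image (modelGen hm w)) (by simpa using closure_modelGen hm w)
    exact h.trans (Finset.card_image_le.trans (by simp))
  · obtain ⟨S, hS, hcl⟩ := Group.rank_spec (G := Model hm w)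
    rw [← hS]
    let T : Finset (Fin 3 → ZMod p) := S.image fun g => (modelReduction hm w g).toAdd
    -- Lower bound for the rank: a generating set of the model maps to a spanning set of `𝔽_p³`.
    have hle : Subgroup.closure (S : Set (Model hm w)) ≤
        (AddSubgroup.toSubgroup (Submodule.span (ZMod p) (T : Set _)).toAddSubgroup).comap
          (modelReduction hm w) := by
      rw [Subgroup.closure_le]
      intro g hg
      exact Submodule.subset_span (Finset.mem_coe.2 (Finset.mem_image_of_mem _ hg))
    have htop : Submodule.span (ZMod p) (T : Set (Fin 3 → ZMod p)) = ⊤ := by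
      rw [eq_top_iff]
      rintro v -
      obtain ⟨g, hg⟩ := modelReduction_surjective hm w (.ofAdd v)
      have := hle (by rw [hcl]; exact Subgroup.mem_top g)
      rw [Subgroup.mem_comap, hg] at this
      exact this
    have h1 := finrank_span_finset_le_card (R := ZMod p) T
    rw [Set.finrank, htop, finrank_top, Module.finrank_fin_fun] at h1
    exact h1.trans Finset.card_image_le

theorem isThreeGenGroup_model [Fact p.Prime] : IsThreeGenGroup p m (Model hm w) where
  isPGroup := IsPGroup.of_card (card_model hm w)
  rank_eq := rank_model hm w
  frattini_le_center := frattini_model_le_center hm w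
  derived := ⟨(MulEquiv.subgroupCongr (commutator_model hm w)).trans
    (MonoidHom.ofInjective (modelIncl_injective hm w)).symm⟩
  abelianization := ⟨(QuotientGroup.quotientMulEquivOfEq
      ((commutator_model hm w).trans (ker_modelPowReduction hm w).symm)).trans
    (QuotientGroup.quotientKerEquivOfSurjective _ (modelPowReduction_surjective hm w))⟩

theorem isCharacteristicMatrix_model [Fact p.Prime] :
    IsCharacteristicMatrix p m (Model hm w) w := by
  have hp : p.Prime := Fact.out
  have hmem : ∀ c, modelIncl hm w c ∈ commutator (Model hm w) := fun c => by
    rw [commutator_model]; exact ⟨c, rfl⟩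
  have hpow : ∀ i, Abelianization.of (modelGen hm w i) ^ p ^ m i = 1 := fun i => by
    rw [← map_pow, modelGen_pow, ← MonoidHom.mem_ker, Abelianization.ker_of]
    exact hmem _
  have hgen : ∀ x, ∃ r : Fin 3 → ℤ, x = ∏ i, Abelianization.of (modelGen hm w i) ^ r i := by
    intro x
    obtain ⟨g, rfl⟩ := QuotientGroup.mk_surjective x
    obtain ⟨g, rfl⟩ := proj_surjective hm w g
    obtain ⟨c, hc⟩ := eq_mul_incl g
    refine ⟨g.base, ?_⟩
    have h1 : Abelianization.of (modelIncl hm w c) = 1 := by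
      rw [← MonoidHom.mem_ker, Abelianization.ker_of]; exact hmem c
    change Abelianization.of (proj hm w g) = _
    conv_lhs => rw [hc]
    rw [map_mul (proj hm w), map_mul (proj hm w), map_mul (proj hm w), map_zpow (proj hm w),
      map_zpow (proj hm w), map_zpow (proj hm w), Fin.prod_univ_three]
    change Abelianization.of (modelGen hm w 0 ^ _ * modelGen hm w 1 ^ _ * modelGen hm w 2 ^ _ *
      modelIncl hm w c) = _
    rw [map_mul, map_mul, map_mul, map_zpow, map_zpow, map_zpow, h1, mul_one]
  obtain ⟨ho, hbij⟩ := orderOf_eq_and_bijective (fun i => pow_pos hp.pos (m i))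
    (isThreeGenGroup_model hm w).card_abelianization hpow hgen
  refine ⟨modelGen hm w, ho, hbij, fun i => ?_⟩
  rw [modelGen_pow, modelIncl_eq]

end Quotient

end CrossExtension

theorem theorem3p1 (p : ℕ) [Fact p.Prime] (η : ZMod p) (hη : p ≠ 2 → ¬ IsSquare η)
    (m : Fin 3 → ℕ) (h₁₂ : m 0 > m 1) (h₂₃ : m 1 > m 2) (h₃ : 0 < m 2) :
    (∀ (G : Type*) [Group G] [Finite G], IsThreeGenGroup p m G →
      ∃ w, IsListed p η w ∧ IsCharacteristicMatrix p m G w) ∧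
    (∀ w w' : Matrix (Fin 3) (Fin 3) (ZMod p), IsListed p η w → IsListed p η w' → w ≠ w' →
      ∀ (G : Type*) [Group G] [Finite G] (H : Type*) [Group H] [Finite H],
        IsThreeGenGroup p m G → IsThreeGenGroup p m H →
        IsCharacteristicMatrix p m G w → IsCharacteristicMatrix p m H w' →
        IsEmpty (G ≃* H)) ∧
    (∀ w, IsListed p η w →
      ∃ (G : Type) (_ : Group G) (_ : Finite G),
        IsThreeGenGroup p m G ∧ IsCharacteristicMatrix p m G w) := by
  have hm : ∀ i, 0 < m i := by
    intro i; fin_cases i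
    · exact (h₃.trans h₂₃).trans h₁₂
    · exact h₃.trans h₂₃
    · exact h₃
  refine ⟨fun G _ _ h => h.exists_isListed hη h₁₂ h₂₃ h₃, ?_, fun w _ => ?_⟩
  · intro w w' hw hw' hne G _ _ H _ _ hG _ hGw hHw
    exact hw.isEmpty_mulEquiv hη h₁₂ h₂₃ h₃ hw' hne hG hGw hHw
  -- The model realises every matrix over `𝔽_p`, listed or not.
  · exact ⟨CrossExtension.Model hm w, inferInstance, inferInstance,
      CrossExtension.isThreeGenGroup_model hm w, CrossExtension.isCharacteristicMatrix_model hm w⟩
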